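/- A \emph{finite graph} is a compact connected space $G$ containing a finite set $V$ such that $G\setminus V$ has finitely many connected components, each of which is homeomorphic to an open interval. Let $T$ be a \emph{lifted space}: a connected metric space with a homeomorphism $h$ of $\mathbb R$ onto its image $h(\mathbb R)\subset T$ and a homeomorphism $\tau\colon T\to T$ such that (i) $\tau(h(t))=h(t+1)$ for all $t\in\mathbb R$; (ii) the closure of each connected component of $T\setminus h(\mathbb R)$ is compact and meets $h(\mathbb R)$ at exactly one point; (iii) only finitely many connected components $C$ of $T\setminus h(\mathbb R)$ satisfy $\overline C\cap h([0,1])\neq\emptyset$. Identify $h(\mathbb R)$ with $\mathbb R$ and write $x+k$ for $\tau^k(x)$, $x\in T$, $k\in\mathbb Z$. Let $r\colon T\to\mathbb R$ be the natural retraction: $r(x)=x$ for $x\in\mathbb R$ and, if $x$ lies in a connected component $C$ of $T\setminus\mathbb R$, $r(x)$ is the unique point of $\overline C\cap\mathbb R$. Assume that $T$ is an \emph{infinite graph}, that is, $r^{-1}([0,1])$ is a finite graph. Let $F\colon T\to T$ be continuous of degree one, that is, $F(x+1)=F(x)+1$ for all $x\in T$. The rotation number $\rho_F(x)$ of $x\in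 T$ exists and equals $\rho\in\mathbb R$ if $$\liminf_{n\to\infty}\frac{r(F^n(x))-r(x)}{n}=\limsup_{n\to\infty}\frac{r(F^n(x))-r(x)}{n}=\rho .$$ Let $\mathrm{Rot}_{\mathbb R}(F)=\{\rho_F(x) : x\in\mathbb R \text{ and } \rho_F(x)\text{ exists}\}$. A point $x\in T$ is \emph{periodic (mod 1)} if $F^n(x)=x+k$ for some integers $n\ge 1$ and $k$. \textbf{Theorem.} Let $p\in\mathbb Z$ and let $q\ge 1$ be an integer. If $\min\mathrm{Rot}_{\mathbb R}(F)=p/q$, then there is a periodic (mod 1) point $x\in T$ (possibly outside $\mathbb R$) with $\rho_F(x)=p/q$. Likewise, if $\max\mathrm{Rot}_{\mathbb R}(F)=p/q$, then there is a periodic (mod 1) point $x\in T$ (possibly outside $\mathbb R$) with $\rho_F(x)=p/q$. -/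

import Mathlib

open Set Filter Topology

/-- A set `C` is a connected component of the subset `S` of a topological space. -/
def IsComponentOf {X : Type*} [TopologicalSpace X] (C S : Set X) : Prop :=
  ∃ x ∈ S, C = connectedComponentIn S x

/-- A subset `G` of a topological space is a (topological) finite graph: it is compact and
connected, and after removing a finite set `V ⊆ G` what is left has finitely many connected
components, each homeomorphic to an open interval. -/
def IsFiniteGraph {X : Type*} [TopologicalSpace X] (G : Set X) : Prop :=
  IsCompact G ∧ IsConnected G ∧
    ∃ V : Set X, V ⊆ G ∧ V.Finite ∧
      {C : Set X | IsComponentOf C (G \ V)}.Finite ∧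
      ∀ C : Set X, IsComponentOf C (G \ V) → Nonempty (C ≃ₜ Ioo (0 : ℝ) 1)

/-- The structure of a lifted space on a connected metric space `T`: a homeomorphism `h` of `ℝ`
onto its image in `T`, and a homeomorphism `τ` of `T` onto itself (written `x ↦ x + 1`). -/
structure LiftedSpace (T : Type*) [MetricSpace T] [ConnectedSpace T] where
  /-- the distinguished copy of the real line -/
  h : ℝ → T
  isEmbedding_h : IsEmbedding h
  /-- the translation by one -/
  τ : T ≃ₜ T
  τ_h : ∀ t : ℝ, τ (h t) = h (t + 1)
  closure_component : ∀ C : Set T, IsComponentOf C (range h)ᶜ →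
    IsCompact (closure C) ∧ ∃ z : T, closure C ∩ range h = {z}
  finite_components :
    {C : Set T | IsComponentOf C (range h)ᶜ ∧ (closure C ∩ h '' Icc 0 1).Nonempty}.Finite

namespace LiftedSpace

variable {T : Type*} [MetricSpace T] [ConnectedSpace T] (L : LiftedSpace T)

/-- `t` is the parameter of the retraction of `x` to the line: either `x` is the point `h t` of
the line, or `x` is off the line and the closure of its component meets the line at `h t`. -/
def IsFoot (x : T) (t : ℝ) : Prop :=
  x = L.h t ∨ (x ∉ range L.h ∧ L.h t ∈ closure (connectedComponentIn (range L.h)ᶜ x))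

theorem existsUnique_isFoot (x : T) : ∃! t : ℝ, L.IsFoot x t := by
  by_cases hx : x ∈ range L.h
  · obtain ⟨t, rfl⟩ := hx
    refine ⟨t, Or.inl rfl, ?_⟩
    rintro s (hs | ⟨hs, -⟩)
    · exact (L.isEmbedding_h.injective hs).symm
    · exact absurd (mem_range_self t) hs
  · obtain ⟨-, z, hz⟩ := L.closure_component _ ⟨x, hx, rfl⟩
    have hz' : z ∈ closure (connectedComponentIn (range L.h)ᶜ x) ∩ range L.h := by
      rw [hz]; rfl
    obtain ⟨hzc, t, rfl⟩ := hz'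
    refine ⟨t, Or.inr ⟨hx, hzc⟩, ?_⟩
    rintro s (hs | ⟨-, hs⟩)
    · exact absurd ⟨s, hs.symm⟩ hx
    · have : L.h s ∈ ({L.h t} : Set T) := by
        rw [← hz]; exact ⟨hs, mem_range_self s⟩
      exact L.isEmbedding_h.injective this

/-- The natural retraction of `T` to the line, the line being identified with `ℝ` by `h`. -/
noncomputable def r (x : T) : ℝ := (L.existsUnique_isFoot x).choose

theorem isFoot_r (x : T) : L.IsFoot x (L.r x) := (L.existsUnique_isFoot x).choose_spec.1

theorem r_eq_of_isFoot {x : T} {t : ℝ} (ht : L.IsFoot x t) : L.r x = t :=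
  (L.existsUnique_isFoot x).unique (L.isFoot_r x) ht

/-- `T` is an infinite graph: the part of `T` that retracts to `[0,1]` is a finite graph. -/
def IsInfiniteGraph : Prop := IsFiniteGraph {x : T | L.r x ∈ Icc (0 : ℝ) 1}

/-- `F` is a continuous map of degree one: `F (x + 1) = F x + 1`. -/
def IsDegreeOne (F : T → T) : Prop := Continuous F ∧ ∀ x, F (L.τ x) = L.τ (F x)

/-- The lower rotation number of `x`, in the extended reals. -/
noncomputable def lowerRotation (F : T → T) (x : T) : EReal :=
  liminf (fun n : ℕ => (((L.r (F^[n] x) - L.r x) / n : ℝ) : EReal)) atTop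

/-- The upper rotation number of `x`, in the extended reals. -/
noncomputable def upperRotation (F : T → T) (x : T) : EReal :=
  limsup (fun n : ℕ => (((L.r (F^[n] x) - L.r x) / n : ℝ) : EReal)) atTop

/-- The rotation number of `x` exists and is equal to the real number `ρ`. -/
def HasRotationNumber (F : T → T) (x : T) (ρ : ℝ) : Prop :=
  L.lowerRotation F x = ρ ∧ L.upperRotation F x = ρ

/-- The set of the rotation numbers (where they exist) of the points of the line. -/
def rotR (F : T → T) : Set ℝ := {ρ | ∃ t : ℝ, L.HasRotationNumber F (L.h t) ρ}

/-- `x` is periodic (mod 1): `F^n x = x + k` for some positive `n` and some integer `k`. -/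
def IsPeriodicModOne (F : T → T) (x : T) : Prop :=
  ∃ n : ℕ, 0 < n ∧ ∃ k : ℤ, F^[n] x = (L.τ ^ k) x

end LiftedSpace

/-! Passing from `F` to `G = τ^(-p) ∘ F^q` turns the rotation number `p/q` into `0`, and a periodic
point of `G` is a periodic (mod 1) point of `F` with rotation number `p/q`. Reversing the line
exchanges maximum and minimum. Of the minimality only this is used: no point of the line satisfies
`G^n x = x + k` with `n > 0` and `k < 0`.

Suppose that `G` has no periodic point. Then every iterate of `G` moves the line to the right
(`lt_r_iterate`), and no orbit starting on the line is bounded on the right, because a bounded one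
would produce a finite invariant set (`exists_periodic_of_forall_le`). Let `U` be the connected
union of all images of the line. Since some point of the line has rotation number `0`, compactness
modulo `τ` gives a point `z` of `closure U` that is never moved to the right
(`exists_forall_r_iterate_le`). It is not in `U`, whose orbits are unbounded on the right. In a
graph `closure U \ U` is finite modulo `τ`, and `G` permutes it modulo `τ`, so some `G^m` translates
each of its points (`exists_iterate_eq_zpow`). A translation to the left is impossible by
`le_r_of_mem_closure_diff`: the points of `U` near such a point would lie in a closed subset of `U`.
Hence `G^m z = z`, a contradiction.

This argument needs a continuous `r`, but the axioms yield continuity of `r` only over compact parts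
of the line. It is therefore run in the coarsest refinement of the topology that makes `r`
continuous. That the map stays continuous there rests on `continuous_r_path`: `r` is continuous
along paths, and a finite graph is a finite union of points and paths. -/

theorem zpow_apply_line {T : Type*} [TopologicalSpace T] {τ : T ≃ₜ T} {h : ℝ → T}
    (hτ : ∀ t, τ (h t) = h (t + 1)) (k : ℤ) (t : ℝ) : (τ ^ k) (h t) = h (t + k) := by
  induction k with
  | zero => simp
  | succ n ih =>
    rw [add_comm, zpow_add, zpow_one, Homeomorph.mul_apply, ih, hτ]; push_cast
    congr 1; ring
  | pred n ih =>
    apply τ.injective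
    rw [← Homeomorph.mul_apply, ← zpow_one_add, add_sub_cancel, ih, hτ]; push_cast
    congr 1; ring

/-- A line `h` in a topological space `T` together with a (not necessarily continuous) retraction
`r` of `T` to it and a compatible translation `τ`, such that the parts of `T` that lie over a
compact set are compact. -/
structure BranchedLine (T : Type*) [TopologicalSpace T] where
  /-- the retraction, in the parameter of the line -/
  r : T → ℝ
  /-- the line -/
  h : ℝ → T
  /-- the translation by one -/
  τ : T ≃ₜ T
  continuous_h : Continuous h
  r_h : ∀ t, r (h t) = t
  r_τ : ∀ x, r (τ x) = r x + 1
  τ_h : ∀ t, τ (h t) = h (t + 1)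
  -- Fibres over `D` are kept whole; over the rest of `B` only the line is kept. `D = univ` gives
  -- compact preimages, and `D = {u}ᶜ` serves to show that the branches at `u` form an open set.
  isCompact_over : ∀ B D : Set ℝ, IsCompact B → IsCompact {x | r x ∈ B ∧ (r x ∈ D ∨ x ∈ range h)}

namespace BranchedLine

/-! ### Lines with branches: reversal, translations, and the finer topology -/

section Basic

variable {T : Type*} [TopologicalSpace T] (W : BranchedLine T)

/-- The same line with the opposite orientation. -/
def neg : BranchedLine T where
  r x := -W.r x
  h t := W.h (-t)
  τ := W.τ.symm
  continuous_h := W.continuous_h.comp continuous_neg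
  r_h t := by rw [W.r_h, neg_neg]
  r_τ x := by
    have := W.r_τ (W.τ.symm x)
    rw [W.τ.apply_symm_apply] at this
    linarith
  τ_h t := by
    rw [W.τ.symm_apply_eq, W.τ_h]
    congr 1; ring
  isCompact_over B D hB := by
    have := W.isCompact_over (Neg.neg ⁻¹' B) (Neg.neg ⁻¹' D)
      ((Homeomorph.neg ℝ).isCompact_preimage.2 hB)
    convert this using 3
    rw [← neg_surjective.range_comp W.h]
    rfl

theorem isCompact_preimage {B : Set ℝ} (hB : IsCompact B) : IsCompact (W.r ⁻¹' B) := by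
  simpa [preimage] using W.isCompact_over B univ hB

theorem mem_range_h {x : T} : x ∈ range W.h ↔ x = W.h (W.r x) := by
  constructor
  · rintro ⟨t, rfl⟩; rw [W.r_h]
  · intro hx; rw [hx]; exact mem_range_self _

theorem r_τ_zpow (k : ℤ) (x : T) : W.r ((W.τ ^ k) x) = W.r x + k := by
  induction k with
  | zero => simp
  | succ n ih =>
    rw [add_comm, zpow_add, zpow_one, Homeomorph.mul_apply, W.r_τ, ih]; push_cast; ring
  | pred n ih =>
    have := W.r_τ ((W.τ ^ (-(n : ℤ) - 1)) x)
    rw [← Homeomorph.mul_apply, ← zpow_one_add, add_sub_cancel, ih] at this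
    push_cast at this ⊢; linarith

theorem τ_zpow_h (k : ℤ) (t : ℝ) : (W.τ ^ k) (W.h t) = W.h (t + k) :=
  zpow_apply_line W.τ_h k t

/-- Preimages under `r` of closed parts of `B` are compact, hence closed. -/
theorem continuousOn_r [T2Space T] {B : Set ℝ} (hB : IsCompact B) :
    ContinuousOn W.r (W.r ⁻¹' B) := by
  rw [continuousOn_iff_isClosed]
  intro Z hZ
  refine ⟨W.r ⁻¹' (B ∩ Z), (W.isCompact_preimage (hB.inter_right hZ)).isClosed, ?_⟩
  ext x; simp only [mem_inter_iff, mem_preimage]; tauto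

/-- Translations commute with the maps that commute with `τ`. -/
theorem commute_zpow {F : T → T} (hF : Function.Commute F W.τ) (k : ℤ) :
    Function.Commute F (W.τ ^ k : T ≃ₜ T) := by
  intro x
  induction k with
  | zero => simp
  | succ n ih =>
    rw [add_comm, zpow_add, zpow_one, Homeomorph.mul_apply, Homeomorph.mul_apply, hF, ih]
  | pred n ih =>
    apply W.τ.injective
    rw [← hF, ← Homeomorph.mul_apply, ← Homeomorph.mul_apply, ← zpow_one_add, add_sub_cancel, ih]

theorem zpow_apply_zpow_neg (k : ℤ) (x : T) : (W.τ ^ k) ((W.τ ^ (-k)) x) = x := by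
  rw [← Homeomorph.mul_apply, ← zpow_add, add_neg_cancel, zpow_zero]; rfl

theorem zpow_apply_zpow (k l : ℤ) (x : T) : (W.τ ^ k) ((W.τ ^ l) x) = (W.τ ^ (k + l)) x := by
  rw [← Homeomorph.mul_apply, ← zpow_add]

theorem zpow_comp_commute {F : T → T} (hF : Function.Commute F W.τ) (k : ℤ) :
    Function.Commute (fun x => (W.τ ^ k) (F x)) W.τ := by
  intro x
  change (W.τ ^ k) (F (W.τ x)) = W.τ ((W.τ ^ k) (F x))
  rw [hF.eq, ← Homeomorph.mul_apply, ← Homeomorph.mul_apply, mul_self_zpow, mul_zpow_self]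

/-- The space `T` with the coarsest topology that refines its own and makes the retraction
continuous. -/
def Fine (_ : BranchedLine T) : Type _ := T

/-- The identity map to the finer space. -/
def toFine : T ≃ W.Fine := Equiv.refl T

instance : TopologicalSpace W.Fine :=
  TopologicalSpace.induced (fun x : W.Fine => (W.toFine.symm x, W.r (W.toFine.symm x))) inferInstance

theorem isInducing_fine :
    IsInducing (fun x : W.Fine => (W.toFine.symm x, W.r (W.toFine.symm x))) := ⟨rfl⟩

theorem continuous_toFine_symm : Continuous W.toFine.symm :=
  continuous_fst.comp W.isInducing_fine.continuous

theorem continuous_r_toFine_symm : Continuous (fun x => W.r (W.toFine.symm x)) :=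
  continuous_snd.comp W.isInducing_fine.continuous

instance [T2Space T] : T2Space W.Fine :=
  T2Space.of_injective_continuous W.toFine.symm.injective W.continuous_toFine_symm

theorem continuousOn_toFine {X : Type*} [TopologicalSpace X] {f : X → T} {s : Set X}
    (hf : ContinuousOn f s) (hr : ContinuousOn (fun x => W.r (f x)) s) :
    ContinuousOn (fun x => W.toFine (f x)) s :=
  W.isInducing_fine.continuousOn_iff.2 (hf.prodMk hr)

theorem continuous_toFine {X : Type*} [TopologicalSpace X] {f : X → T}
    (hf : Continuous f) (hr : Continuous (fun x => W.r (f x))) :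
    Continuous (fun x => W.toFine (f x)) :=
  W.isInducing_fine.continuous_iff.2 (hf.prodMk hr)

/-- The line in the finer topology. -/
def fine [T2Space T] : BranchedLine W.Fine where
  r x := W.r (W.toFine.symm x)
  h t := W.toFine (W.h t)
  τ :=
    { toEquiv := (W.toFine.symm.trans W.τ.toEquiv).trans W.toFine
      continuous_toFun := W.continuous_toFine
        (f := fun x => W.τ (W.toFine.symm x))
        (W.τ.continuous.comp W.continuous_toFine_symm) (by
        simp only [W.r_τ]
        exact W.continuous_r_toFine_symm.add continuous_const)
      continuous_invFun := W.continuous_toFine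
        (f := fun x => W.τ.symm (W.toFine.symm x))
        (W.τ.symm.continuous.comp W.continuous_toFine_symm) (by
        have : ∀ x, W.r (W.τ.symm x) = W.r x - 1 := fun x => by
          have := W.r_τ (W.τ.symm x)
          rw [W.τ.apply_symm_apply] at this
          linarith
        simp only [this]
        exact W.continuous_r_toFine_symm.sub continuous_const) }
  continuous_h := W.continuous_toFine W.continuous_h (by
    simp only [W.r_h]; exact continuous_id)
  r_h := W.r_h
  r_τ x := W.r_τ _
  τ_h := W.τ_h
  isCompact_over B D hB := by
    have h3 := (W.isCompact_over B D hB).image_of_continuousOn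
      (W.continuousOn_toFine continuousOn_id ((W.continuousOn_r hB).mono fun x hx => hx.1))
    convert h3 using 1
    ext x
    exact (exists_eq_right (p := fun x : T => W.r x ∈ B ∧ (W.r x ∈ D ∨ x ∈ range W.h))).symm

end Basic

/-! ### Connected sets crossing a level, and cutting at a level -/

section Crossing

variable {T : Type*} [TopologicalSpace T] (W : BranchedLine T)

/-- Near level `u`, the line and the fibres over the other levels form a compact set; removing it
leaves exactly the branches at `u`. -/
theorem isOpen_branch [T2Space T] (hr : Continuous W.r) (u : ℝ) : IsOpen {x | W.r x = u ∧ x ≠ W.h u} := by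
  have h1 : IsOpen (W.r ⁻¹' Ioo (u - 1) (u + 1)) := isOpen_Ioo.preimage hr
  have h2 := (W.isCompact_over (Icc (u - 1) (u + 1)) {u}ᶜ isCompact_Icc).isClosed
  convert h1.sdiff h2 using 1
  ext x
  simp only [mem_ofPred_eq, Set.mem_sdiff, mem_preimage, mem_Ioo, mem_Icc, W.mem_range_h,
    mem_compl_iff, mem_singleton_iff]
  constructor
  · rintro ⟨rfl, hx⟩
    exact ⟨⟨by linarith, by linarith⟩, fun h => by
      rcases h.2 with h | h
      · exact h rfl
      · exact hx h⟩
  · rintro ⟨⟨h1, h2⟩, h3⟩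
    have : W.r x = u := by
      by_contra h; exact h3 ⟨⟨h1.le, h2.le⟩, Or.inl h⟩
    refine ⟨this, fun h => h3 ⟨⟨h1.le, h2.le⟩, Or.inr ?_⟩⟩
    rw [this]; exact h

/-- If `S` missed `h u`, it would be separated by the open sets `r > u` and `r < u`, the latter
enlarged by the open set of branches at `u`. This plays the role of the intermediate value theorem.
-/
theorem h_mem_of_isPreconnected [T2Space T] (hr : Continuous W.r) {S : Set T} (hS : IsPreconnected S) {x y : T}
    (hx : x ∈ S) (hy : y ∈ S) {u : ℝ} (hxu : W.r x < u) (huy : u < W.r y) : W.h u ∈ S := by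
  by_contra hu
  have h1 : IsOpen (W.r ⁻¹' Iio u ∪ {x | W.r x = u ∧ x ≠ W.h u}) :=
    (isOpen_Iio.preimage hr).union (W.isOpen_branch hr u)
  have h2 : IsOpen (W.r ⁻¹' Ioi u) := isOpen_Ioi.preimage hr
  obtain ⟨z, -, hz1, hz2⟩ := hS _ _ h1 h2 (fun z hz => by
    rcases lt_trichotomy (W.r z) u with h | h | h
    · exact Or.inl (Or.inl h)
    · exact Or.inl (Or.inr ⟨h, fun h' => hu (h' ▸ hz)⟩)
    · exact Or.inr h) ⟨x, hx, Or.inl hxu⟩ ⟨y, hy, huy⟩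
  have hz2 : u < W.r z := hz2
  rcases hz1 with h | h
  · exact lt_asymm hz2 h
  · exact hz2.ne' h.1

/-- The retraction of `T` to the part of `T` on the left of `a`. -/
noncomputable def cut (a : ℝ) (x : T) : T := open Classical in if W.r x ≤ a then x else W.h a

theorem cut_of_le {a : ℝ} {x : T} (hx : W.r x ≤ a) : W.cut a x = x := if_pos hx

theorem cut_of_lt {a : ℝ} {x : T} (hx : a < W.r x) : W.cut a x = W.h a := if_neg hx.not_ge

theorem r_cut (a : ℝ) (x : T) : W.r (W.cut a x) = min (W.r x) a := by
  rcases le_or_gt (W.r x) a with h | h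
  · rw [W.cut_of_le h, min_eq_left h]
  · rw [W.cut_of_lt h, W.r_h, min_eq_right h.le]

/-- The two formulas could disagree only on the branches at `a`, which are open and so interior to
`r ≤ a`. -/
theorem continuous_cut [T2Space T] (hr : Continuous W.r) (a : ℝ) : Continuous (W.cut a) := by
  classical
  refine Continuous.if (fun x hx => ?_) continuous_id continuous_const
  have h1 : W.r x = a := frontier_le_subset_eq hr continuous_const hx
  by_contra h2
  refine hx.2 (mem_interior.2 ⟨_, fun y hy => ?_, W.isOpen_branch hr a, h1, h2⟩)
  exact hy.1.le

end Crossing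

end BranchedLine

namespace BranchedLine

/-! ### Continuity of the retraction along paths -/

section Path

variable {T : Type*} [TopologicalSpace T] [T2Space T] (W : BranchedLine T)

/-- A path cannot run through the whole end of the line in finite time. -/
theorem false_of_path_escape {p : ℝ → T} (hp : Continuous p) {c s v : ℝ} (hcs : c < s)
    (hcont : ContinuousOn (fun x => W.r (p x)) (Ioc c s)) (hc : W.r (p c) < v)
    (hv : ∀ x ∈ Ioc c s, p x ≠ W.h v) (hs : v < W.r (p s)) : False := by
  have cross : ∀ s₁ ≤ s, ∀ x ∈ Ioc c s₁, ∀ y ∈ Ioc c s₁, ∀ u, W.r (p x) < u → u < W.r (p y) →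
      ∃ z ∈ Ioc c s₁, p z = W.h u := by
    intro s₁ hs₁ x hx y hy u hxu huy
    have h1 : IsPreconnected ((fun x => W.toFine (p x)) '' Ioc c s₁) :=
      isPreconnected_Ioc.image _ ((W.continuousOn_toFine hp.continuousOn hcont).mono
        (Ioc_subset_Ioc_right hs₁))
    obtain ⟨z, hz, hzu⟩ := W.fine.h_mem_of_isPreconnected W.continuous_r_toFine_symm h1
      (mem_image_of_mem _ hx) (mem_image_of_mem _ hy) (u := u) hxu huy
    exact ⟨z, hz, W.toFine.injective hzu⟩
  have hge : ∀ x ∈ Ioc c s, v ≤ W.r (p x) := by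
    intro x hx
    by_contra! h
    obtain ⟨z, hz, hzv⟩ := cross s le_rfl x hx s ⟨hcs, le_rfl⟩ v h hs
    exact hv z hz hzv
  have hmem : ∀ s₁ > c, Ioc c s₁ ∈ 𝓝[>] c := fun s₁ h => Ioc_mem_nhdsGT h
  -- Otherwise `p` would be in the closed set `r⁻¹ [v, M]` at times tending to `c`, and so would `p
  -- c`.
  have htop : Tendsto (fun x => W.r (p x)) (𝓝[>] c) atTop := by
    refine tendsto_atTop.2 fun M => ?_
    by_contra hM
    have h1 : ∃ᶠ x in 𝓝[>] c, p x ∈ W.r ⁻¹' Icc v M := by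
      refine ((not_eventually.1 hM).and_eventually (hmem s hcs)).mono fun x hx => ?_
      exact ⟨hge x hx.2, (not_le.1 hx.1).le⟩
    have h2 := (W.isCompact_preimage isCompact_Icc).isClosed.mem_of_frequently_of_tendsto h1
      ((hp.tendsto c).mono_left nhdsWithin_le_nhds)
    exact hc.not_ge h2.1
  -- Arbitrarily soon after `c` the path runs through all `h u` with `u` large, so the line
  -- converges to `p c`. Then `τ` fixes `p c`, which `r_τ` forbids.
  have hlim : Tendsto W.h atTop (𝓝 (p c)) := by
    intro Z hZ
    have h1 : p ⁻¹' Z ∈ 𝓝[>] c := ((hp.tendsto c).mono_left nhdsWithin_le_nhds) hZ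
    obtain ⟨s₁, hs₁, hsub⟩ := (mem_nhdsGT_iff_exists_Ioc_subset).1 h1
    rw [mem_map]
    have hs₁' : c < min s₁ s := lt_min hs₁ hcs
    filter_upwards [eventually_gt_atTop (W.r (p (min s₁ s)))] with u hu
    obtain ⟨y, hy1, hy2⟩ := ((htop.eventually_gt_atTop u).and (hmem _ hs₁')).exists
    obtain ⟨z, hz, hzu⟩ := cross _ (min_le_right _ _) _ ⟨hs₁', le_rfl⟩ y hy2 u hu hy1
    have : p z ∈ Z := hsub ⟨hz.1, hz.2.trans (min_le_left _ _)⟩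
    rw [hzu] at this
    exact this
  have h1 : Tendsto (fun t => W.τ (W.h t)) atTop (𝓝 (W.τ (p c))) :=
    (W.τ.continuous.tendsto _).comp hlim
  have h2 : Tendsto (fun t => W.τ (W.h t)) atTop (𝓝 (p c)) := by
    simp only [W.τ_h]
    exact hlim.comp (tendsto_atTop_add_const_right _ _ tendsto_id)
  have h3 := W.r_τ (p c)
  rw [tendsto_nhds_unique h1 h2] at h3
  linarith

theorem continuousAt_r_of_eventually {p : ℝ → T} (hp : Continuous p) {s M : ℝ}
    (hM : ∀ᶠ x in 𝓝 s, |W.r (p x)| ≤ M) : ContinuousAt (fun x => W.r (p x)) s := by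
  have h1 : ∀ᶠ x in 𝓝 s, p x ∈ W.r ⁻¹' Icc (-M) M := hM.mono fun x hx => abs_le.1 hx
  exact (W.continuousOn_r isCompact_Icc (p s) h1.self_of_nhds).tendsto.comp
    (tendsto_nhdsWithin_iff.2 ⟨hp.tendsto s, h1⟩)

/-- Between a time `s₀` and a later time `s` with `r` too large there is a contradiction, if at the
times in between at which `r` is not locally bounded along the path its value is small. -/
theorem r_le_of_path {p : ℝ → T} (hp : Continuous p) {P : Set ℝ} (hP : IsClosed P)
    (hcont : ∀ x ∉ P, ContinuousAt (fun x => W.r (p x)) x) {s₀ s v : ℝ} (hs₀ : s₀ ∈ P)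
    (hs : s₀ ≤ s) (hPv : ∀ x ∈ P ∩ Icc s₀ s, W.r (p x) < v) (hv : ∀ x ∈ Icc s₀ s, p x ≠ W.h v) :
    W.r (p s) ≤ v := by
  by_contra! hlt
  have hcpt : IsCompact (P ∩ Icc s₀ s) := isCompact_Icc.inter_left hP
  obtain ⟨c, hc, hmax⟩ := hcpt.exists_isGreatest ⟨s₀, hs₀, le_rfl, hs⟩
  have hcs : c < s := by
    refine lt_of_le_of_ne hc.2.2 ?_
    rintro rfl
    exact lt_asymm hlt (hPv c hc)
  refine W.false_of_path_escape hp hcs (fun x hx => ?_) (hPv c hc)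
    (fun x hx => hv x ⟨hc.2.1.trans hx.1.le, hx.2⟩) hlt
  refine (hcont x fun hxP => ?_).continuousWithinAt
  exact hx.1.not_ge (hmax ⟨hxP, hc.2.1.trans hx.1.le, hx.2⟩)

/-- The retraction is continuous along every path. -/
theorem continuous_r_path {p : ℝ → T} (hp : Continuous p) : Continuous (fun x => W.r (p x)) := by
  set P : Set ℝ := {s | ¬ ∃ M, ∀ᶠ x in 𝓝 s, |W.r (p x)| ≤ M} with hPdef
  have hP : IsClosed P := by
    rw [← isOpen_compl_iff, isOpen_iff_mem_nhds]
    intro s hs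
    obtain ⟨M, hM⟩ := not_not.1 hs
    filter_upwards [hM.eventually_nhds] with x hx
    exact not_not.2 ⟨M, hx⟩
  have hcont : ∀ x ∉ P, ContinuousAt (fun x => W.r (p x)) x := by
    intro x hx
    obtain ⟨M, hM⟩ := not_not.1 hx
    exact W.continuousAt_r_of_eventually hp hM
  rcases P.eq_empty_or_nonempty with hPe | hPne
  · exact continuous_iff_continuousAt.2 fun x => hcont x (by simp [hPe])
  exfalso
  have : Nonempty P := hPne.to_subtype
  have : CompleteSpace P := hP.completeSpace_coe
  -- Baire category in the closed set `P` of bad times: `|r ∘ p| ≤ N` on a relatively open part of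
  -- `P`. Near `s₀` the path also avoids `h (±(N + 1))`, so it cannot escape past these levels
  -- between bad times; `r ∘ p` is then bounded near `s₀`.
  obtain ⟨N, ⟨s₀, hs₀⟩, hN⟩ := nonempty_interior_of_iUnion_of_closed
    (f := fun N : ℕ => {x : P | p x ∈ W.r ⁻¹' Icc (-(N : ℝ)) N})
    (fun N => (W.isCompact_preimage isCompact_Icc).isClosed.preimage (hp.comp continuous_subtype_val))
    (by
      refine eq_univ_of_forall fun x => mem_iUnion.2 ?_
      obtain ⟨N, hN⟩ := exists_nat_ge |W.r (p x)|
      exact ⟨N, abs_le.1 hN⟩)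
  have hN' : ∀ᶠ x in 𝓝 s₀, x ∈ P → |W.r (p x)| ≤ N := by
    have := mem_interior_iff_mem_nhds.1 hN
    rw [nhds_subtype_eq_comap, mem_comap] at this
    obtain ⟨Z, hZ, hsub⟩ := this
    filter_upwards [hZ] with x hx hxP
    exact abs_le.2 (hsub (a := ⟨x, hxP⟩) hx)
  have hne : ∀ v : ℝ, |v| = N + 1 → ∀ᶠ x in 𝓝 s₀, p x ≠ W.h v := by
    intro v hv
    refine hp.continuousAt.eventually_ne fun h => ?_
    have h1 := hN'.self_of_nhds hs₀
    rw [h, W.r_h, hv] at h1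
    linarith
  have h1 : (0 : ℝ) ≤ N + 1 := by positivity
  obtain ⟨δ, hδ, hball⟩ := Metric.eventually_nhds_iff_ball.1
    ((hN'.and (hne (N + 1) (abs_of_nonneg h1))).and (hne (-(N + 1)) (by rw [abs_neg, abs_of_nonneg h1])))
  refine hs₀ ⟨N + 1, ?_⟩
  filter_upwards [Metric.ball_mem_nhds s₀ hδ] with s hs
  rw [Real.ball_eq_Ioo] at hs hball
  have key : ∀ x ∈ P, x ∈ Ioo (s₀ - δ) (s₀ + δ) → W.r (p x) < N + 1 ∧ -W.r (p x) < N + 1 := by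
    intro x hxP hx
    have := abs_le.1 ((hball x hx).1.1 hxP)
    constructor <;> linarith [this.1, this.2]
  have hP' : IsClosed (Neg.neg ⁻¹' P) := hP.preimage continuous_neg
  have hp' : Continuous (fun x => p (-x)) := hp.comp continuous_neg
  have hcontn : ∀ x ∉ P, ContinuousAt (fun x => W.neg.r (p x)) x := fun x hx => (hcont x hx).neg
  have hcont' : ∀ x ∉ Neg.neg ⁻¹' P, ContinuousAt (fun x => W.r (p (-x))) x := fun x hx =>
    ContinuousAt.comp (f := fun x : ℝ => -x) (hcont (-x) hx) continuousAt_neg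
  have hcontn' : ∀ x ∉ Neg.neg ⁻¹' P, ContinuousAt (fun x => W.neg.r (p (-x))) x := fun x hx =>
    (hcont' x hx).neg
  rw [abs_le']
  rcases le_total s₀ s with h | h
  · have hI : ∀ x ∈ Icc s₀ s, x ∈ Ioo (s₀ - δ) (s₀ + δ) := fun x hx =>
      ⟨by linarith [hx.1], hx.2.trans_lt hs.2⟩
    exact ⟨W.r_le_of_path hp hP hcont hs₀ h (fun x hx => (key x hx.1 (hI x hx.2)).1)
        fun x hx => (hball x (hI x hx)).1.2,
      W.neg.r_le_of_path hp hP hcontn hs₀ h (fun x hx => (key x hx.1 (hI x hx.2)).2)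
        fun x hx => (hball x (hI x hx)).2⟩
  · have hI : ∀ x ∈ Icc (-s₀) (-s), -x ∈ Ioo (s₀ - δ) (s₀ + δ) := fun x hx =>
      ⟨by linarith [hx.2, hs.1], by linarith [hx.1]⟩
    have hm : -s₀ ∈ Neg.neg ⁻¹' P := by simpa using hs₀
    have h1 := W.r_le_of_path hp' hP' hcont' hm (neg_le_neg h)
      (fun x hx => (key (-x) hx.1 (hI x hx.2)).1) fun x hx => (hball _ (hI x hx)).1.2
    have h2 := W.neg.r_le_of_path hp' hP' hcontn' hm (neg_le_neg h)
      (fun x hx => (key (-x) hx.1 (hI x hx.2)).2) fun x hx => (hball _ (hI x hx)).2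
    rw [neg_neg] at h1 h2
    exact ⟨h1, h2⟩

end Path

end BranchedLine

/-! ### Edges, paths and connected subsets of finite graphs -/

section FiniteGraph

theorem mem_connectedComponentIn_of_mem_closure {X : Type*} [TopologicalSpace X] {S : Set X}
    {x y : X} (hyS : y ∈ S) (hy : y ∈ closure (connectedComponentIn S x)) :
    y ∈ connectedComponentIn S x := by
  have hx : x ∈ S := by
    by_contra hx
    simp [connectedComponentIn_eq_empty hx] at hy
  have h1 : IsPreconnected (insert y (connectedComponentIn S x)) :=
    isPreconnected_connectedComponentIn.subset_closure (subset_insert _ _)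
      (insert_subset hy subset_closure)
  exact h1.subset_connectedComponentIn (mem_insert_of_mem _ (mem_connectedComponentIn hx))
    (insert_subset hyS (connectedComponentIn_subset _ _)) (mem_insert _ _)

/-- A parametrization of an open edge of a graph `G` by the unit interval. -/
structure IsEdge {X : Type*} [TopologicalSpace X] (G : Set X) (e : ℝ → X) : Prop where
  continuousOn : ContinuousOn e (Ioo 0 1)
  injOn : InjOn e (Ioo 0 1)
  exists_isOpen : ∀ Z ⊆ Ioo (0 : ℝ) 1, IsOpen Z → ∃ O, IsOpen O ∧ e '' Z = G ∩ O

theorem IsEdge.reflect {X : Type*} [TopologicalSpace X] {G : Set X} {e : ℝ → X}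
    (he : IsEdge G e) : IsEdge G (fun s => e (1 - s)) where
  continuousOn := he.continuousOn.comp (by fun_prop)
    fun s hs => ⟨by linarith [hs.2], by linarith [hs.1]⟩
  injOn s hs t ht h := by
    have := he.injOn (x₁ := 1 - s) (x₂ := 1 - t) ⟨by linarith [hs.2], by linarith [hs.1]⟩
      ⟨by linarith [ht.2], by linarith [ht.1]⟩ h
    linarith
  exists_isOpen Z hZ hZo := by
    obtain ⟨O, hO, h⟩ := he.exists_isOpen ((fun s => 1 - s) ⁻¹' Z)
      (fun s hs => ⟨by linarith [(hZ hs).2], by linarith [(hZ hs).1]⟩)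
      (hZo.preimage (by fun_prop))
    refine ⟨O, hO, ?_⟩
    rw [← h]
    ext x
    constructor
    · rintro ⟨s, hs, rfl⟩
      exact ⟨1 - s, by simpa using hs, rfl⟩
    · rintro ⟨s, hs, rfl⟩
      exact ⟨1 - s, hs, by simp⟩

/-- A finite graph is the union of a finite set and of finitely many disjoint open edges. -/
theorem IsFiniteGraph.exists_edges {X : Type*} [TopologicalSpace X] [T1Space X] {G : Set X}
    (hG : IsFiniteGraph G) : ∃ V : Set X, V.Finite ∧ ∃ 𝒥 : Set (Set X), 𝒥.Finite ∧ G ⊆ V ∪ ⋃₀ 𝒥 ∧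
      (∀ J ∈ 𝒥, ∃ e, IsEdge G e ∧ e '' Ioo 0 1 = J) ∧
      ∀ J ∈ 𝒥, ∀ J' ∈ 𝒥, (J ∩ J').Nonempty → J = J' := by
  obtain ⟨-, -, V, -, hV, hfin, hhom⟩ := hG
  have hdisj : ∀ J, IsComponentOf J (G \ V) → ∀ x ∈ J, J = connectedComponentIn (G \ V) x := by
    rintro J ⟨y, hy, rfl⟩ x hx
    exact connectedComponentIn_eq hx
  refine ⟨V, hV, _, hfin, fun x hx => ?_, fun J hJ => ?_, fun J hJ J' hJ' ⟨x, hx, hx'⟩ => ?_⟩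
  · by_cases hxV : x ∈ V
    · exact Or.inl hxV
    · exact Or.inr ⟨_, ⟨x, ⟨hx, hxV⟩, rfl⟩, mem_connectedComponentIn ⟨hx, hxV⟩⟩
  · obtain ⟨φ⟩ := hhom J hJ
    have hJsub : J ⊆ G \ V := by
      obtain ⟨x, hx, rfl⟩ := hJ
      exact connectedComponentIn_subset _ _
    obtain ⟨O, hO, hJO⟩ : ∃ O, IsOpen O ∧ J = (G \ V) ∩ O := by
      -- There are finitely many components, so the closures of the others form a closed set, and it
      -- misses `J`.
      refine ⟨(⋃ J' ∈ {J' | IsComponentOf J' (G \ V)} \ {J}, closure J')ᶜ,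
        (hfin.sdiff.isClosed_biUnion fun _ _ => isClosed_closure).isOpen_compl, ?_⟩
      ext x
      simp only [mem_inter_iff, mem_compl_iff, mem_iUnion, not_exists]
      constructor
      · intro hx
        refine ⟨hJsub hx, ?_⟩
        rintro _ ⟨⟨y, hy, rfl⟩, hne⟩ hxJ'
        have hx' := mem_connectedComponentIn_of_mem_closure (hJsub hx) hxJ'
        exact hne ((connectedComponentIn_eq hx').trans (hdisj J hJ x hx).symm)
      · rintro ⟨hx, hO⟩
        by_contra hxJ
        refine hO (connectedComponentIn (G \ V) x) ⟨⟨x, hx, rfl⟩, ?_⟩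
          (subset_closure (mem_connectedComponentIn hx))
        rintro rfl
        exact hxJ (mem_connectedComponentIn hx)
    classical
    obtain ⟨x₀, hx₀⟩ : J.Nonempty := by
      obtain ⟨x, hx, rfl⟩ := hJ
      exact ⟨x, mem_connectedComponentIn hx⟩
    set e : ℝ → X := fun s => if hs : s ∈ Ioo (0 : ℝ) 1 then φ.symm ⟨s, hs⟩ else x₀ with he
    have hes : ∀ s (hs : s ∈ Ioo (0 : ℝ) 1), e s = φ.symm ⟨s, hs⟩ := fun s hs => dif_pos hs
    have himg : ∀ Z ⊆ Ioo (0 : ℝ) 1, e '' Z = Subtype.val '' (φ ⁻¹' (Subtype.val ⁻¹' Z)) := by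
      intro Z hZ
      ext x
      constructor
      · rintro ⟨s, hs, rfl⟩
        rw [hes s (hZ hs)]
        exact ⟨φ.symm ⟨s, hZ hs⟩, by simpa using hs, rfl⟩
      · rintro ⟨y, hy, rfl⟩
        refine ⟨φ y, hy, ?_⟩
        rw [hes _ (φ y).2]
        simp
    refine ⟨e, ⟨?_, ?_, ?_⟩, ?_⟩
    · rw [continuousOn_iff_continuous_domRestrict]
      have : (Ioo (0 : ℝ) 1).domRestrict e = fun s => (φ.symm s : X) := by
        funext s
        exact hes s s.2
      rw [this]
      exact continuous_subtype_val.comp φ.symm.continuous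
    · intro s hs t ht h
      rw [hes s hs, hes t ht] at h
      simpa using φ.symm.injective (Subtype.ext h)
    · intro Z hZ hZo
      obtain ⟨O', hO', h⟩ := isOpen_induced_iff.1 ((hZo.preimage continuous_subtype_val).preimage
        φ.continuous)
      refine ⟨Vᶜ ∩ O ∩ O', (hV.isClosed.isOpen_compl.inter hO).inter hO', ?_⟩
      rw [himg Z hZ, ← h, Subtype.image_preimage_coe, hJO]
      ext x
      simp only [mem_inter_iff, Set.mem_sdiff, mem_compl_iff]
      tauto
    · rw [himg _ Subset.rfl]
      ext x
      simp
  · rw [hdisj J hJ x hx, ← hdisj J' hJ' x hx']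

/-- A path in a compact set whose cluster points at `0` form a finite set converges at `0`. -/
theorem exists_tendsto_of_finite_clusterPt {X : Type*} [MetricSpace X] {G V : Set X}
    (hG : IsCompact G) (hV : V.Finite) {f : ℝ → X} (hf : ContinuousOn f (Ioo 0 1))
    (hfG : MapsTo f (Ioo 0 1) G) (hfV : ∀ x, MapClusterPt x (𝓝[>] 0) f → x ∈ V) :
    ∃ v, Tendsto f (𝓝[>] 0) (𝓝 v) := by
  have hev : ∀ δ > (0 : ℝ), Ioo 0 δ ∈ 𝓝[>] (0 : ℝ) := fun δ hδ => Ioo_mem_nhdsGT hδ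
  have hGl : ∀ᶠ s in 𝓝[>] (0 : ℝ), f s ∈ G := mem_of_superset (hev 1 one_pos) hfG
  obtain ⟨v, -, hv⟩ := hG.exists_mapClusterPt_of_frequently hGl.frequently
  refine ⟨v, hG.le_nhds_of_unique_clusterPt hGl fun w _ hw => ?_⟩
  have hw : MapClusterPt w (𝓝[>] 0) f := hw
  by_contra hwv
  -- With two cluster points `v` and `w`, the path would cross every sphere around `v` of radius
  -- below `dist w v` at times tending to `0`. A radius avoiding the finitely many distances from
  -- `V` to `v` then yields a cluster point outside `V`.
  obtain ⟨ε, ⟨hε0, hε⟩, hεV⟩ := (Ioo_infinite (dist_pos.2 hwv)).exists_notMem_finite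
    (hV.image fun u => dist u v)
  have h1 : ∃ᶠ s in 𝓝[>] (0 : ℝ), dist (f s) v < ε := hv.frequently (Metric.ball_mem_nhds v hε0)
  have h2 : ∃ᶠ s in 𝓝[>] (0 : ℝ), ε < dist (f s) v :=
    hw.frequently ((isOpen_lt continuous_const (continuous_id.dist continuous_const)).mem_nhds hε)
  have h3 : ∃ᶠ s in 𝓝[>] (0 : ℝ), f s ∈ G ∩ Metric.sphere v ε := by
    refine frequently_iff.2 fun {U} hU => ?_
    obtain ⟨δ, hδ, hsub⟩ := mem_nhdsGT_iff_exists_Ioo_subset.1 hU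
    have hδ' : 0 < min δ 1 := lt_min hδ one_pos
    obtain ⟨a, ha, haI⟩ := (h1.and_eventually (hev _ hδ')).exists
    obtain ⟨b, hb, hbI⟩ := (h2.and_eventually (hev _ hδ')).exists
    have hI : Ioo 0 (min δ 1) ⊆ Ioo (0 : ℝ) 1 := Ioo_subset_Ioo_right (min_le_right _ _)
    obtain ⟨c, hc, hce⟩ := isPreconnected_Ioo.intermediate_value haI hbI
      (f := fun s => dist (f s) v) ((continuous_id.dist continuous_const).comp_continuousOn (hf.mono hI)) ⟨ha.le, hb.le⟩
    exact ⟨c, hsub ⟨hc.1, hc.2.trans_le (min_le_left _ _)⟩, hfG (hI hc), hce⟩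
  obtain ⟨u, ⟨-, hu⟩, hul⟩ :=
    (hG.inter_right Metric.isClosed_sphere).exists_mapClusterPt_of_frequently h3
  exact hεV ⟨u, hfV u hul, hu⟩

theorem IsEdge.exists_tendsto_zero {X : Type*} [MetricSpace X] {G V : Set X} (hG : IsCompact G)
    (hV : V.Finite) {𝒥 : Set (Set X)} (hGV : G ⊆ V ∪ ⋃₀ 𝒥)
    (hedge : ∀ J ∈ 𝒥, ∃ e, IsEdge G e ∧ e '' Ioo 0 1 = J)
    (hdisj : ∀ J ∈ 𝒥, ∀ J' ∈ 𝒥, (J ∩ J').Nonempty → J = J')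
    {e : ℝ → X} (he : IsEdge G e) (heJ : e '' Ioo 0 1 ∈ 𝒥) :
    ∃ v, Tendsto e (𝓝[>] 0) (𝓝 v) := by
  have hsub : ∀ e, IsEdge G e → MapsTo e (Ioo 0 1) G := by
    intro e he s hs
    obtain ⟨O, -, h⟩ := he.exists_isOpen _ Subset.rfl isOpen_Ioo
    exact (h.subset (mem_image_of_mem _ hs)).1
  have hev : ∀ δ > (0 : ℝ), Ioo 0 δ ∈ 𝓝[>] (0 : ℝ) := fun δ hδ => Ioo_mem_nhdsGT hδ
  refine exists_tendsto_of_finite_clusterPt hG hV he.continuousOn (hsub e he) fun x hx => ?_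
  by_contra hxV
  have hxG : x ∈ G := hG.isClosed.mem_of_mapClusterPt hx (mem_of_superset (hev 1 one_pos) (hsub e he))
  obtain ⟨J, hJ, hxJ⟩ := (hGV hxG).resolve_left hxV
  obtain ⟨e', he', rfl⟩ := hedge J hJ
  have key : ∀ Z ⊆ Ioo (0 : ℝ) 1, IsOpen Z → x ∈ e' '' Z → ∃ᶠ s in 𝓝[>] (0 : ℝ), e s ∈ e' '' Z := by
    intro Z hZ hZo hxZ
    obtain ⟨O, hO, h⟩ := he'.exists_isOpen Z hZ hZo
    rw [h] at hxZ ⊢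
    refine ((hx.frequently (hO.mem_nhds hxZ.2)).and_eventually (hev 1 one_pos)).mono ?_
    exact fun s hs => ⟨hsub e he hs.2, hs.1⟩
  obtain ⟨s, hs, hsI⟩ := ((key _ Subset.rfl isOpen_Ioo hxJ).and_eventually (hev 1 one_pos)).exists
  have hJJ := hdisj _ heJ _ hJ ⟨e s, mem_image_of_mem _ hsI, hs⟩
  rw [← hJJ] at hxJ
  obtain ⟨s₀, hs₀, rfl⟩ := hxJ
  -- The part of the edge beyond `s₀ / 2` is relatively open around `e s₀`; by injectivity `e s`
  -- stays out of it for small `s`.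
  have hZ : Ioo (s₀ / 2) 1 ⊆ Ioo (0 : ℝ) 1 := Ioo_subset_Ioo_left (by linarith [hs₀.1])
  obtain ⟨O, hO, h⟩ := he.exists_isOpen _ hZ isOpen_Ioo
  have h0 : e s₀ ∈ e '' Ioo (s₀ / 2) 1 := mem_image_of_mem _ ⟨by linarith [hs₀.1], hs₀.2⟩
  rw [h] at h0
  obtain ⟨s, hsO, hs⟩ := ((hx.frequently (hO.mem_nhds h0.2)).and_eventually
    (hev (min (s₀ / 2) 1) (lt_min (by linarith [hs₀.1]) one_pos))).exists
  have hs1 : s ∈ Ioo (0 : ℝ) 1 := ⟨hs.1, hs.2.trans_le (min_le_right _ _)⟩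
  have h2 : e s ∈ e '' Ioo (s₀ / 2) 1 := by
    rw [h]; exact ⟨hsub e he hs1, hsO⟩
  obtain ⟨s', hs', heq⟩ := h2
  rw [he.injOn (hZ hs') hs1 heq] at hs'
  exact absurd hs'.1 (hs.2.trans_le (min_le_left _ _)).not_gt

/-- A finite graph in a metric space is a finite union of a finite set and of paths. -/
theorem IsFiniteGraph.exists_paths {X : Type*} [MetricSpace X] {G : Set X} (hG : IsFiniteGraph G) :
    ∃ V : Set X, V.Finite ∧ ∃ P : Set (ℝ → X), P.Finite ∧ (∀ p ∈ P, Continuous p) ∧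
      G ⊆ V ∪ ⋃ p ∈ P, p '' Icc 0 1 := by
  obtain ⟨V, hV, 𝒥, h𝒥, hGV, hedge, hdisj⟩ := hG.exists_edges
  have hpath : ∀ J ∈ 𝒥, ∃ p : ℝ → X, Continuous p ∧ J ⊆ p '' Icc 0 1 := by
    intro J hJ
    obtain ⟨e, he, rfl⟩ := hedge J hJ
    obtain ⟨v, hv⟩ := IsEdge.exists_tendsto_zero hG.1 hV hGV hedge hdisj he hJ
    have himg : (fun s => e (1 - s)) '' Ioo 0 1 = e '' Ioo 0 1 := by
      rw [← image_image e (fun s => 1 - s), image_const_sub_Ioo]; simp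
    obtain ⟨w, hw⟩ := IsEdge.exists_tendsto_zero hG.1 hV hGV hedge hdisj he.reflect
      (himg.symm ▸ hJ)
    have hw' : Tendsto e (𝓝[<] 1) (𝓝 w) := by
      have h1 : Tendsto (fun s : ℝ => 1 - s) (𝓝[<] 1) (𝓝[>] 0) := by
        refine tendsto_nhdsWithin_iff.2 ⟨?_, ?_⟩
        · have : Tendsto (fun s : ℝ => 1 - s) (𝓝 1) (𝓝 (1 - 1)) :=
            Continuous.tendsto (by fun_prop) 1
          rw [sub_self] at this
          exact this.mono_left nhdsWithin_le_nhds
        · filter_upwards [self_mem_nhdsWithin] with s hs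
          exact sub_pos.2 (mem_Iio.1 hs)
      simpa [Function.comp_def] using hw.comp h1
    have hc := continuousOn_Icc_extendFrom_Ioo he.continuousOn hv hw'
    refine ⟨IccExtend zero_le_one ((Icc (0 : ℝ) 1).domRestrict (extendFrom (Ioo 0 1) e)),
      (continuousOn_iff_continuous_domRestrict.1 hc).Icc_extend', ?_⟩
    rintro _ ⟨s, hs, rfl⟩
    refine ⟨s, Ioo_subset_Icc_self hs, ?_⟩
    rw [IccExtend_of_mem _ _ (Ioo_subset_Icc_self hs)]
    exact extendFrom_extends he.continuousOn s hs
  have : Nonempty X := ⟨hG.2.1.nonempty.some⟩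
  choose! p hp hJp using hpath
  refine ⟨V, hV, p '' 𝒥, h𝒥.image p, ?_, fun x hx => ?_⟩
  · rintro _ ⟨J, hJ, rfl⟩
    exact hp J hJ
  · refine (hGV hx).imp_right ?_
    rintro ⟨J, hJ, hxJ⟩
    exact mem_biUnion (mem_image_of_mem p hJ) (hJp J hJ hxJ)

/-- A connected subset of a finite graph has only finitely many boundary points outside it. -/
theorem IsFiniteGraph.finite_closure_diff {X : Type*} [TopologicalSpace X] [T2Space X] {G : Set X}
    (hG : IsFiniteGraph G) {S : Set X} (hSG : S ⊆ G) (hS : IsPreconnected S) :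
    (closure S \ S).Finite := by
  obtain ⟨V, hV, 𝒥, h𝒥, hGV, hedge, -⟩ := hG.exists_edges
  have hcl : closure S ⊆ G := closure_minimal hSG hG.1.isClosed
  suffices h : ∀ J ∈ 𝒥, ((closure S \ S) ∩ J).Finite by
    refine (hV.union (h𝒥.biUnion h)).subset fun x hx => ?_
    refine (hGV (hcl hx.1)).imp_right ?_
    rintro ⟨J, hJ, hxJ⟩
    exact mem_biUnion hJ ⟨hx, hxJ⟩
  intro J hJ
  obtain ⟨e, he, rfl⟩ := hedge J hJ
  set B : Set ℝ := {s | s ∈ Ioo (0 : ℝ) 1 ∧ e s ∈ closure S \ S} with hB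
  -- Each edge carries at most two such points. With three, `S` would lie in the arc between the
  -- outer two, hence on one side of the middle one, and its closure would miss an outer one.
  suffices h : ∀ x₁ ∈ B, ∀ x₂ ∈ B, ∀ x₃ ∈ B, x₁ < x₂ → x₂ < x₃ → False by
    have hBfin : B.Finite := by
      by_contra hinf
      obtain ⟨t, htB, htcard⟩ := Set.Infinite.exists_subset_card_eq hinf 3
      exact h _ (htB (t.orderEmbOfFin_mem htcard 0)) _ (htB (t.orderEmbOfFin_mem htcard 1)) _
        (htB (t.orderEmbOfFin_mem htcard 2))
        ((t.orderEmbOfFin htcard).strictMono (by decide))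
        ((t.orderEmbOfFin htcard).strictMono (by decide))
    refine (hBfin.image e).subset ?_
    rintro _ ⟨hx, s, hs, rfl⟩
    exact ⟨s, ⟨hs, hx⟩, rfl⟩
  intro x₁ h₁ x₂ h₂ x₃ h₃ h12 h23
  -- an arc between two points outside `S` with a point of the closure inside contains `S`
  have arc : ∀ a ∈ Ioo (0 : ℝ) 1, ∀ b ∈ Ioo (0 : ℝ) 1, e a ∉ S → e b ∉ S →
      S ∩ e '' Ioo a b ≠ ∅ → S ⊆ e '' Icc a b := by
    intro a ha b hb haS hbS hne
    have hsub : Ioo a b ⊆ Ioo (0 : ℝ) 1 := Ioo_subset_Ioo ha.1.le hb.2.le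
    have hsub' : Icc a b ⊆ Ioo (0 : ℝ) 1 := fun x hx => ⟨ha.1.trans_le hx.1, hx.2.trans_lt hb.2⟩
    obtain ⟨O, hO, hOe⟩ := he.exists_isOpen _ hsub isOpen_Ioo
    have hK : IsCompact (e '' Icc a b) :=
      isCompact_Icc.image_of_continuousOn (he.continuousOn.mono hsub')
    have hmem : ∀ x ∈ S, x ∈ e '' Icc a b → x ∈ e '' Ioo a b := by
      rintro _ hx ⟨s, hs, rfl⟩
      refine ⟨s, ⟨lt_of_le_of_ne hs.1 ?_, lt_of_le_of_ne hs.2 ?_⟩, rfl⟩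
      · rintro rfl; exact haS hx
      · rintro rfl; exact hbS hx
    have hSO : ∀ x ∈ S, x ∈ O ↔ x ∈ e '' Ioo a b := fun x hx => by
      rw [hOe]; exact ⟨fun h => ⟨hSG hx, h⟩, fun h => h.2⟩
    rcases isPreconnected_iff_subset_of_disjoint.1 hS O (e '' Icc a b)ᶜ hO hK.isClosed.isOpen_compl
      (fun x hx => by
        by_cases h : x ∈ e '' Icc a b
        · exact Or.inl ((hSO x hx).2 (hmem x hx h))
        · exact Or.inr h)
      (by
        refine eq_empty_of_forall_notMem fun x hx => hx.2.2 ?_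
        exact image_mono Ioo_subset_Icc_self ((hSO x hx.1).1 hx.2.1)) with h | h
    · exact fun x hx => image_mono Ioo_subset_Icc_self ((hSO x hx).1 (h hx))
    · exfalso
      refine hne (eq_empty_of_forall_notMem fun x hx => h hx.1 ?_)
      exact image_mono Ioo_subset_Icc_self hx.2
  have hmeet : ∀ a ∈ Ioo (0 : ℝ) 1, ∀ b ∈ Ioo (0 : ℝ) 1, ∀ x ∈ B, a < x → x < b →
      S ∩ e '' Ioo a b ≠ ∅ := by
    intro a ha b hb x hx hax hxb
    obtain ⟨O, hO, hOe⟩ := he.exists_isOpen _ (Ioo_subset_Ioo ha.1.le hb.2.le) isOpen_Ioo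
    have hxO : e x ∈ e '' Ioo a b := mem_image_of_mem _ ⟨hax, hxb⟩
    rw [hOe] at hxO ⊢
    obtain ⟨y, hyO, hyS⟩ := mem_closure_iff.1 hx.2.1 O hO hxO.2
    exact Nonempty.ne_empty ⟨y, hyS, hSG hyS, hyO⟩
  have h13 := arc x₁ h₁.1 x₃ h₃.1 h₁.2.2 h₃.2.2 (hmeet _ h₁.1 _ h₃.1 _ h₂ h12 h23)
  have hclosed : ∀ a ∈ Ioo (0 : ℝ) 1, ∀ b ∈ Ioo (0 : ℝ) 1, S ⊆ e '' Icc a b → ∀ x ∈ B,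
      x ∈ Icc a b := by
    intro a ha b hb hsub x hx
    have hsub' : Icc a b ⊆ Ioo (0 : ℝ) 1 := fun x hx => ⟨ha.1.trans_le hx.1, hx.2.trans_lt hb.2⟩
    have hK : IsCompact (e '' Icc a b) :=
      isCompact_Icc.image_of_continuousOn (he.continuousOn.mono hsub')
    obtain ⟨s, hs, hse⟩ := closure_minimal hsub hK.isClosed hx.2.1
    rwa [he.injOn (hsub' hs) hx.1 hse] at hs
  obtain ⟨y, hy⟩ : S.Nonempty := closure_nonempty_iff.1 ⟨_, h₁.2.1⟩
  obtain ⟨s, hs, rfl⟩ := h13 hy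
  rcases lt_trichotomy s x₂ with h | rfl | h
  · have h1 : x₁ < s := lt_of_le_of_ne hs.1 (by rintro rfl; exact h₁.2.2 hy)
    exact ((hclosed _ h₁.1 _ h₂.1 (arc x₁ h₁.1 x₂ h₂.1 h₁.2.2 h₂.2.2
      (Nonempty.ne_empty ⟨_, hy, s, ⟨h1, h⟩, rfl⟩)) _ h₃).2).not_gt h23
  · exact h₂.2.2 hy
  · have h1 : s < x₃ := lt_of_le_of_ne hs.2 (by rintro rfl; exact h₃.2.2 hy)
    exact ((hclosed _ h₂.1 _ h₃.1 (arc x₂ h₂.1 x₃ h₃.1 h₂.2.2 h₃.2.2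
      (Nonempty.ne_empty ⟨_, hy, s, ⟨h, h1⟩, rfl⟩)) _ h₁).1).not_gt h12

end FiniteGraph

namespace BranchedLine

/-! ### Finiteness of boundary points over compact parts of the line -/

section Ends

variable {T : Type*} [TopologicalSpace T] (W : BranchedLine T)

theorem exists_eq_zpow (x : T) : ∃ y, x = (W.τ ^ ⌊W.r x⌋) y ∧ W.r y ∈ Ico (0 : ℝ) 1 := by
  refine ⟨(W.τ ^ (-⌊W.r x⌋)) x, ?_, ?_⟩
  · exact (W.zpow_apply_zpow_neg _ x).symm
  · rw [W.r_τ_zpow]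
    push_cast
    exact ⟨by linarith [Int.floor_le (W.r x)], by linarith [Int.lt_floor_add_one (W.r x)]⟩

/-- Over each compact part of the line, every connected subset of `T` has only finitely many
boundary points that do not belong to it. -/
def FiniteEnds : Prop :=
  ∀ U : Set T, IsPreconnected U → ∀ a b : ℝ, ((closure U \ U) ∩ W.r ⁻¹' Icc a b).Finite

theorem FiniteEnds.neg {W : BranchedLine T} (hW : W.FiniteEnds) : W.neg.FiniteEnds := by
  intro U hU a b
  refine (hW U hU (-b) (-a)).subset ?_
  rintro x ⟨hx, h1, h2⟩
  have h1 : a ≤ -W.r x := h1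
  have h2 : -W.r x ≤ b := h2
  exact ⟨hx, by linarith, by linarith⟩

/-- Retracting `U` to the part over `[0,1]` keeps it connected and creates at most the new points `h
0` and `h 1`. Translations handle the other unit intervals. -/
theorem finiteEnds_of_unit [T2Space T] (hr : Continuous W.r)
    (hG : ∀ S ⊆ W.r ⁻¹' Icc 0 1, IsPreconnected S → (closure S \ S).Finite) : W.FiniteEnds := by
  have hrn : Continuous W.neg.r := hr.neg
  have h01 : ∀ U : Set T, IsPreconnected U → ((closure U \ U) ∩ W.r ⁻¹' Icc 0 1).Finite := by
    intro U hU
    set c : T → T := fun x => W.neg.cut 0 (W.cut 1 x) with hc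
    have hcont : Continuous c := (W.neg.continuous_cut hrn 0).comp (W.continuous_cut hr 1)
    have hc_mem : ∀ x, W.r x ∈ Icc (0 : ℝ) 1 → c x = x := by
      intro x hx
      simp only [hc]
      rw [W.cut_of_le hx.2, W.neg.cut_of_le]
      exact neg_nonpos.2 hx.1
    have hc_notMem : ∀ x, W.r x ∉ Icc (0 : ℝ) 1 → c x = W.h 0 ∨ c x = W.h 1 := by
      intro x hx
      have h0 : W.neg.h 0 = W.h 0 := congrArg W.h neg_zero
      rcases le_or_gt (W.r x) 1 with h | h
      · left
        rw [← h0]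
        simp only [hc]
        rw [W.cut_of_le h, W.neg.cut_of_lt]
        have : W.r x < 0 := by
          by_contra! h'
          exact hx ⟨h', h⟩
        exact neg_pos.2 this
      · right
        simp only [hc]
        rw [W.cut_of_lt h, W.neg.cut_of_le]
        have : W.neg.r (W.h 1) = -1 := congrArg Neg.neg (W.r_h 1)
        rw [this]; norm_num
    refine ((hG (c '' U) ?_ (hU.image c hcont.continuousOn)).union
      ((finite_singleton (W.h 0)).union (finite_singleton (W.h 1)))).subset ?_
    · rintro _ ⟨x, -, rfl⟩
      by_cases hx : W.r x ∈ Icc (0 : ℝ) 1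
      · rw [hc_mem x hx]; exact hx
      · rcases hc_notMem x hx with h | h <;> rw [h] <;> simp [W.r_h]
    · rintro x ⟨⟨hxcl, hxU⟩, hx⟩
      by_cases hxc : x ∈ c '' U
      · right
        obtain ⟨u, hu, rfl⟩ := hxc
        by_cases hu1 : W.r u ∈ Icc (0 : ℝ) 1
        · rw [hc_mem u hu1] at hxU
          exact absurd hu hxU
        · exact hc_notMem u hu1
      · left
        refine ⟨?_, hxc⟩
        have := image_closure_subset_closure_image hcont (mem_image_of_mem c hxcl)
        rwa [hc_mem x hx] at this
  intro U hU a b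
  have hj : ∀ j : ℤ, ((closure U \ U) ∩ W.r ⁻¹' Icc (j : ℝ) (j + 1)).Finite := by
    intro j
    have h1 := h01 ((W.τ ^ (-j)) '' U) (hU.image _ (W.τ ^ (-j)).continuous.continuousOn)
    refine (h1.image (W.τ ^ j)).subset ?_
    rintro x ⟨⟨hxcl, hxU⟩, hx1, hx2⟩
    refine ⟨(W.τ ^ (-j)) x, ⟨⟨?_, ?_⟩, ?_⟩, W.zpow_apply_zpow_neg j x⟩
    · rw [← (W.τ ^ (-j)).image_closure]
      exact mem_image_of_mem _ hxcl
    · rintro ⟨y, hy, hyx⟩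
      rw [(W.τ ^ (-j)).injective hyx] at hy
      exact hxU hy
    · rw [mem_preimage, W.r_τ_zpow]
      push_cast
      exact ⟨by linarith, by linarith⟩
  refine ((finite_Icc ⌊a⌋ ⌊b⌋).biUnion fun j _ => hj j).subset ?_
  rintro x ⟨hx, h1, h2⟩
  exact mem_biUnion (x := ⌊W.r x⌋) ⟨Int.floor_mono h1, Int.floor_mono h2⟩
    ⟨hx, Int.floor_le _, (Int.lt_floor_add_one _).le⟩

end Ends

/-! ### Graphs and degree one maps in the finer topology -/

section FineContinuity

variable {T : Type*} [MetricSpace T] (W : BranchedLine T)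

theorem finiteEnds_fine (hG : IsFiniteGraph (W.r ⁻¹' Icc 0 1)) : W.fine.FiniteEnds := by
  refine W.fine.finiteEnds_of_unit W.continuous_r_toFine_symm fun S hS hSc => ?_
  have h1 := hG.finite_closure_diff (S := W.toFine.symm '' S) ?_
    (hSc.image _ W.continuous_toFine_symm.continuousOn)
  · refine (h1.image W.toFine).subset ?_
    rintro x ⟨hx, hxS⟩
    refine ⟨W.toFine.symm x, ⟨?_, ?_⟩, W.toFine.apply_symm_apply x⟩
    · exact image_closure_subset_closure_image W.continuous_toFine_symm (mem_image_of_mem _ hx)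
    · rintro ⟨y, hy, hyx⟩
      rw [W.toFine.symm.injective hyx] at hy
      exact hxS hy
  · rintro _ ⟨x, hx, rfl⟩
    exact hS hx

/-- A continuous map of degree one is continuous for the finer topology, too. -/
theorem continuous_fine_map (hG : IsFiniteGraph (W.r ⁻¹' Icc 0 1)) {F : T → T}
    (hF : Continuous F) (hFτ : Function.Commute F W.τ) :
    Continuous (fun x => W.toFine (F (W.toFine.symm x))) := by
  -- Compactness of the image would not bound `r` on it, since `r` is not known to be continuous.
  -- Covering the unit part by points and paths does.
  obtain ⟨N, hN⟩ : ∃ N : ℝ, ∀ x, W.r x ∈ Icc (0 : ℝ) 1 → |W.r (F x)| ≤ N := by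
    obtain ⟨V, hV, P, hP, hPc, hsub⟩ := hG.exists_paths
    have h1 : BddAbove ((fun x => |W.r (F x)|) '' (V ∪ ⋃ p ∈ P, p '' Icc (0 : ℝ) 1)) := by
      rw [image_union, image_iUnion₂]
      refine (hV.image _).bddAbove.union (hP.bddAbove_biUnion.2 fun p hp => ?_)
      rw [image_image]
      exact (isCompact_Icc.image (W.continuous_r_path (hF.comp (hPc p hp))).abs).bddAbove
    obtain ⟨N, hN⟩ := h1
    exact ⟨N, fun x hx => hN (mem_image_of_mem _ (hsub hx))⟩
  have hbound : ∀ x, |W.r (F x)| ≤ N + |W.r x| + 1 := by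
    intro x
    obtain ⟨y, hxy, hy⟩ := W.exists_eq_zpow x
    have h1 := hN y ⟨hy.1, hy.2.le⟩
    have h2 : F x = (W.τ ^ ⌊W.r x⌋) (F y) := by
      conv_lhs => rw [hxy]
      exact W.commute_zpow hFτ _ y
    rw [h2, W.r_τ_zpow]
    have h3 : |((⌊W.r x⌋ : ℤ) : ℝ)| ≤ |W.r x| + 1 := by
      have h4 : ((⌊W.r x⌋ : ℤ) : ℝ) = W.r x + -Int.fract (W.r x) := by
        rw [← sub_eq_add_neg, Int.self_sub_fract]
      rw [h4]
      refine (abs_add_le _ _).trans ?_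
      rw [abs_neg, abs_of_nonneg (Int.fract_nonneg (W.r x))]
      linarith [Int.fract_lt_one (W.r x)]
    linarith [abs_add_le (W.r (F y)) (⌊W.r x⌋ : ℝ)]
  refine W.continuous_toFine (f := fun x => F (W.toFine.symm x))
    (hF.comp W.continuous_toFine_symm) (continuous_iff_continuousAt.2 fun x => ?_)
  set M : ℝ := |W.r (W.toFine.symm x)| + 1
  have h1 : ∀ᶠ y in 𝓝 x, |W.r (W.toFine.symm y)| < M :=
    (W.continuous_r_toFine_symm.abs.tendsto x).eventually_lt_const (lt_add_one _)
  have h2 : ∀ᶠ y in 𝓝 x, F (W.toFine.symm y) ∈ W.r ⁻¹' Icc (-(N + M + 1)) (N + M + 1) := by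
    filter_upwards [h1] with y hy
    exact abs_le.1 ((hbound _).trans (by linarith))
  exact (W.continuousOn_r isCompact_Icc _ h2.self_of_nhds).tendsto.comp
    (tendsto_nhdsWithin_iff.2 ⟨(hF.comp W.continuous_toFine_symm).tendsto x, h2⟩)

end FineContinuity

end BranchedLine

namespace BranchedLine

/-! ### Displacement of the line under maps of degree one -/

section DegreeOne

variable {T : Type*} [TopologicalSpace T] (W : BranchedLine T)

theorem r_map_h_add {f : T → T} (hfτ : Function.Commute f W.τ) (t : ℝ) (k : ℤ) :
    W.r (f (W.h (t + k))) = W.r (f (W.h t)) + k := by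
  rw [← W.τ_zpow_h, (W.commute_zpow hfτ k).eq, W.r_τ_zpow]

/-- If both signs occurred, degree one would force the graph of `t ↦ r (f (h t))` to meet the
diagonal from below. At such a point `f (h t)` is on an open branch, so the function is locally
constant and cannot come from below. -/
theorem forall_lt_or_forall_gt [T2Space T] (hr : Continuous W.r) {f : T → T} (hf : Continuous f)
    (hfτ : Function.Commute f W.τ) (hne : ∀ t, f (W.h t) ≠ W.h t) :
    (∀ t, t < W.r (f (W.h t))) ∨ ∀ t, W.r (f (W.h t)) < t := by
  set g : ℝ → ℝ := fun t => W.r (f (W.h t)) with hg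
  have hfh : Continuous (fun t => f (W.h t)) := hf.comp W.continuous_h
  have hgc : Continuous g := hr.comp hfh
  have hloc : ∀ z, g z = z → ∀ᶠ t in 𝓝 z, g t = z := by
    intro z hz
    have h1 : (fun t => f (W.h t)) ⁻¹' {x | W.r x = z ∧ x ≠ W.h z} ∈ 𝓝 z :=
      ((W.isOpen_branch hr z).preimage hfh).mem_nhds ⟨hz, hne z⟩
    filter_upwards [h1] with t ht
    exact ht.1
  by_contra! hcon
  obtain ⟨⟨x, hx⟩, y, hy⟩ := hcon
  obtain ⟨x', hx'⟩ : ∃ x', g x' < x' := by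
    rcases hx.lt_or_eq with h | h
    · exact ⟨x, h⟩
    · obtain ⟨t, ht, hxt⟩ := (((hloc x h).filter_mono nhdsWithin_le_nhds).and
        (self_mem_nhdsWithin (s := Ioi x))).exists
      exact ⟨t, ht.trans_lt hxt⟩
  obtain ⟨y', hy', hxy⟩ : ∃ y', y' ≤ g y' ∧ x' < y' := by
    refine ⟨y + (⌊x' - y⌋ + 1 : ℤ), ?_, ?_⟩
    · simp only [hg]
      rw [W.r_map_h_add hfτ]
      exact add_le_add_left hy _
    · push_cast
      linarith [Int.lt_floor_add_one (x' - y)]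
  have hcpt : IsCompact (Icc x' y' ∩ {t | t ≤ g t}) :=
    isCompact_Icc.inter_right (isClosed_le continuous_id hgc)
  obtain ⟨z, ⟨hzI, hz⟩, hmin⟩ := hcpt.exists_isLeast ⟨y', ⟨hxy.le, le_rfl⟩, hy'⟩
  have hxz : x' < z := by
    refine lt_of_le_of_ne hzI.1 ?_
    rintro rfl
    exact hx'.not_ge hz
  have hlt : ∀ᶠ t in 𝓝[<] z, g t < t := by
    filter_upwards [Ioo_mem_nhdsLT hxz] with t ht
    by_contra! h
    exact ht.2.not_ge (hmin ⟨⟨ht.1.le, ht.2.le.trans hzI.2⟩, h⟩)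
  have hgz : g z = z := by
    refine le_antisymm (le_of_tendsto_of_tendsto ((hgc.tendsto z).mono_left nhdsWithin_le_nhds)
      (tendsto_id.mono_left nhdsWithin_le_nhds) (hlt.mono fun t ht => ht.le)) hz
  obtain ⟨t, ⟨ht1, ht2⟩, ht3⟩ := ((hlt.and ((hloc z hgz).filter_mono nhdsWithin_le_nhds)).and
    (self_mem_nhdsWithin (s := Iio z))).exists
  exact lt_asymm (ht2 ▸ ht1) ht3

/-- The image of the line is connected and, by degree one, unbounded in both directions. -/
theorem exists_map_h_eq [T2Space T] (hr : Continuous W.r) {f : T → T} (hf : Continuous f)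
    (hfτ : Function.Commute f W.τ) (u : ℝ) : ∃ t, f (W.h t) = W.h u := by
  have h1 : IsPreconnected (range fun t => f (W.h t)) :=
    isPreconnected_range (hf.comp W.continuous_h)
  have h2 := Int.lt_floor_add_one (u - W.r (f (W.h 0)))
  have h3 := Int.floor_le (u - W.r (f (W.h 0)))
  refine W.h_mem_of_isPreconnected hr h1
    (mem_range_self (0 + ((⌊u - W.r (f (W.h 0))⌋ - 1 : ℤ) : ℝ)))
    (mem_range_self (0 + ((⌊u - W.r (f (W.h 0))⌋ + 1 : ℤ) : ℝ))) ?_ ?_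
  · simp only [W.r_map_h_add hfτ]; push_cast; linarith
  · simp only [W.r_map_h_add hfτ]; push_cast; linarith

theorem exists_gap (hr : Continuous W.r) {f : T → T} (hf : Continuous f)
    (hfτ : Function.Commute f W.τ) (hlt : ∀ t, t < W.r (f (W.h t))) :
    ∃ ε > 0, ∀ t, t + ε ≤ W.r (f (W.h t)) := by
  obtain ⟨s, -, hs⟩ := isCompact_Icc.exists_isMinOn (nonempty_Icc.2 (zero_le_one (α := ℝ)))
    (f := fun t => W.r (f (W.h t)) - t)
    ((hr.comp (hf.comp W.continuous_h)).sub continuous_id).continuousOn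
  refine ⟨W.r (f (W.h s)) - s, sub_pos.2 (hlt s), fun t => ?_⟩
  have h1 : W.r (f (W.h s)) - s ≤ W.r (f (W.h (Int.fract t))) - Int.fract t :=
    hs ⟨Int.fract_nonneg t, (Int.fract_lt_one t).le⟩
  have h2 := W.r_map_h_add hfτ (Int.fract t) ⌊t⌋
  rw [Int.fract_add_floor] at h2
  linarith [Int.fract_add_floor t]

/-- A map of degree one without periodic points of nonpositive rotation number on the line moves
the line to the right, if it has a point of rotation number zero on the line. -/
theorem lt_r_iterate [T2Space T] (hr : Continuous W.r) {F : T → T} (hF : Continuous F)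
    (hFτ : Function.Commute F W.τ)
    (hneg : ∀ n : ℕ, 0 < n → ∀ t, ∀ k : ℤ, k ≤ 0 → F^[n] (W.h t) ≠ W.h (t + k))
    {t₀ : ℝ} (h0 : Tendsto (fun n : ℕ => (W.r (F^[n] (W.h t₀)) - t₀) / n) atTop (𝓝 0))
    {n : ℕ} (hn : 0 < n) (t : ℝ) : t < W.r (F^[n] (W.h t)) := by
  have hFn : ∀ m, Function.Commute F^[m] W.τ := fun m => hFτ.iterate_left m
  revert t
  refine (W.forall_lt_or_forall_gt hr (hF.iterate n) (hFn n) fun t => ?_).resolve_right fun hgt => ?_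
  · simpa using hneg n hn t 0 le_rfl
  obtain ⟨ε, hε, hgap⟩ := W.neg.exists_gap hr.neg (hF.iterate n) (f := F^[n])
    (fun x => W.τ.injective (by
      change W.τ (F^[n] (W.τ.symm x)) = W.τ (W.τ.symm (F^[n] x))
      rw [← (hFn n).eq]; simp))
    (fun t => by
      have : W.r (F^[n] (W.h (-t))) < -t := hgt (-t)
      exact lt_neg_of_lt_neg this)
  have hgap : ∀ t, W.r (F^[n] (W.h t)) ≤ t - ε := fun t => by
    have : -t + ε ≤ -W.r (F^[n] (W.h (- -t))) := hgap (-t)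
    rw [neg_neg] at this
    linarith
  -- Images may leave the line, so the gap cannot be iterated forwards. It is iterated backwards:
  -- each point of the line has a preimage on the line, at least `ε` further right.
  have hchain : ∀ k : ℕ, ∃ s, (F^[n])^[k] (W.h s) = W.h 0 ∧ k * ε ≤ s := by
    intro k
    induction k with
    | zero => exact ⟨0, rfl, by simp⟩
    | succ k ih =>
      obtain ⟨s, hs, hks⟩ := ih
      obtain ⟨s', hs'⟩ := W.exists_map_h_eq hr (hF.iterate n) (hFn n) s
      refine ⟨s', by rw [Function.iterate_succ_apply, hs', hs], ?_⟩
      have := hgap s'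
      rw [hs', W.r_h] at this
      push_cast
      linarith
  have hall : ∀ k : ℕ, 0 < k → ∀ t, W.r (F^[n * k] (W.h t)) < t - k * ε + 1 := by
    intro k hk t
    obtain ⟨s, hs, hks⟩ := hchain k
    rw [← Function.iterate_mul] at hs
    -- Here `-j ≤ k * ε ≤ s`, so `τ^(-j) ∘ F^[n * k]` does not move `h s` to the right. It has no
    -- fixed point on the line, so it moves the whole line to the left, and the rotation number of
    -- `h t₀` would be negative.
    set j : ℤ := ⌈-(k * ε)⌉
    have hj : j ≤ 0 := Int.ceil_le.2 (by push_cast; exact neg_nonpos.2 (by positivity))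
    have h1 := W.forall_lt_or_forall_gt hr (f := fun x => (W.τ ^ (-j)) (F^[n * k] x))
      ((W.τ ^ (-j)).continuous.comp (hF.iterate _)) (W.zpow_comp_commute (hFn _) (-j))
      fun t ht => hneg (n * k) (Nat.mul_pos hn hk) t j hj (by
        rw [← W.τ_zpow_h, ← W.zpow_apply_zpow_neg j (F^[n * k] (W.h t))]
        exact congrArg (W.τ ^ j) ht)
    have h2 : ∀ t, W.r (F^[n * k] (W.h t)) - j < t := by
      rcases h1 with h | h
      · have := h s
        rw [hs, W.r_τ_zpow, W.r_h] at this
        push_cast at this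
        linarith [Int.le_ceil (-(k * ε))]
      · intro t
        have := h t
        rw [W.r_τ_zpow] at this
        push_cast at this
        linarith
    linarith [h2 t, Int.ceil_lt_add_one (-(k * ε))]
  have hn' : (0 : ℝ) < n := by exact_mod_cast hn
  have h1 : Tendsto (fun k : ℕ => (W.r (F^[n * k] (W.h t₀)) - t₀) / ((n * k : ℕ) : ℝ)) atTop (𝓝 0) :=
    h0.comp (tendsto_id.const_mul_atTop' hn)
  have h2 : ∀ᶠ k : ℕ in atTop, -(ε / (2 * n)) < (W.r (F^[n * k] (W.h t₀)) - t₀) / ((n * k : ℕ) : ℝ) :=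
    h1.eventually_const_lt (neg_neg_of_pos (by positivity))
  obtain ⟨k, hk, hkε, hk0⟩ := (h2.and ((tendsto_natCast_atTop_atTop.eventually_gt_atTop (2 / ε)).and
    (eventually_gt_atTop 0))).exists
  have hk0' : (0 : ℝ) < k := by exact_mod_cast hk0
  have h3 := hall k hk0 t₀
  rw [lt_div_iff₀ (by positivity)] at hk
  have h4 : -(ε / (2 * n)) * ((n * k : ℕ) : ℝ) = -(k * ε / 2) := by
    push_cast; field_simp
  rw [h4] at hk
  rw [div_lt_iff₀ hε] at hkε
  linarith

end DegreeOne

end BranchedLine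

namespace BranchedLine

/-! ### Compactness and finiteness modulo translation -/

section Translation

variable {T : Type*} [TopologicalSpace T] (W : BranchedLine T)

theorem zpow_mem_closure {U : Set T} (hU : ∀ x ∈ U, ∀ k : ℤ, (W.τ ^ k) x ∈ U) {x : T}
    (hx : x ∈ closure U) (k : ℤ) : (W.τ ^ k) x ∈ closure U := by
  have h1 : (W.τ ^ k) '' U ⊆ U := by
    rintro _ ⟨y, hy, rfl⟩
    exact hU y hy k
  exact closure_mono h1 (image_closure_subset_closure_image (W.τ ^ k).continuous
    (mem_image_of_mem _ hx))

theorem r_iterate_zpow {F : T → T} (hFτ : Function.Commute F W.τ) (n : ℕ) (k : ℤ) (x : T) :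
    W.r (F^[n] ((W.τ ^ k) x)) = W.r (F^[n] x) + k := by
  rw [(W.commute_zpow (hFτ.iterate_left n) k).eq, W.r_τ_zpow]

theorem exists_mem_eq_zpow {Y : Set T} (hY : ∀ x ∈ Y, ∀ k : ℤ, (W.τ ^ k) x ∈ Y) {x : T}
    (hx : x ∈ Y) : ∃ y ∈ Y, ∃ k : ℤ, x = (W.τ ^ k) y ∧ W.r y ∈ Ico (0 : ℝ) 1 := by
  obtain ⟨y, hxy, hy⟩ := W.exists_eq_zpow x
  generalize ⌊W.r x⌋ = k at hxy
  refine ⟨y, ?_, k, hxy, hy⟩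
  have := hY x hx (-k)
  rw [hxy, W.zpow_apply_zpow, neg_add_cancel, zpow_zero] at this
  exact this

/-- In the closure of an orbit of rotation number zero there is a point that is never moved to the
right. -/
theorem exists_forall_r_iterate_le (hr : Continuous W.r) {F : T → T} (hF : Continuous F)
    (hFτ : Function.Commute F W.τ) {Y : Set T} (hY : IsClosed Y) (hYF : MapsTo F Y Y)
    (hYτ : ∀ x ∈ Y, ∀ k : ℤ, (W.τ ^ k) x ∈ Y) {x₀ : T} (hx₀ : x₀ ∈ Y)
    (h0 : Tendsto (fun n : ℕ => (W.r (F^[n] x₀) - W.r x₀) / n) atTop (𝓝 0)) :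
    ∃ z ∈ Y, ∀ n, W.r (F^[n] z) ≤ W.r z := by
  by_contra! hcon
  -- Otherwise, by compactness modulo `τ`, every point of `Y` gains more than a fixed `δ` within `j
  -- + 1` steps, and the orbit of `x₀` has average speed at least `δ / (j + 1)` along infinitely
  -- many times.
  set O : ℕ → Set T := fun j => ⋃ n ≤ j, {x | W.r x + 1 / ((j : ℝ) + 1) < W.r (F^[n] x)} with hO
  have hOo : ∀ j, IsOpen (O j) := fun j => isOpen_biUnion fun n _ =>
    isOpen_lt (hr.add continuous_const) (hr.comp (hF.iterate n))
  have hOmono : Monotone O := by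
    intro i j hij x hx
    simp only [hO, mem_iUnion, mem_ofPred_eq] at hx ⊢
    obtain ⟨n, hn, hx⟩ := hx
    refine ⟨n, hn.trans hij, lt_of_le_of_lt ?_ hx⟩
    have : 1 / ((j : ℝ) + 1) ≤ 1 / ((i : ℝ) + 1) := Nat.one_div_le_one_div hij
    linarith
  obtain ⟨j, hj⟩ := ((W.isCompact_preimage isCompact_Icc).inter_left hY).elim_directed_cover
    (s := Y ∩ W.r ⁻¹' Icc 0 1) O hOo (fun x hx => by
      obtain ⟨n, hn⟩ := hcon x hx.1
      obtain ⟨i, hi⟩ := exists_nat_one_div_lt (sub_pos.2 hn)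
      refine mem_iUnion.2 ⟨max n i, ?_⟩
      simp only [hO, mem_iUnion, mem_ofPred_eq]
      refine ⟨n, le_max_left _ _, ?_⟩
      have : 1 / (((max n i : ℕ) : ℝ) + 1) ≤ 1 / ((i : ℝ) + 1) :=
        Nat.one_div_le_one_div (le_max_right _ _)
      linarith) (directed_of_isDirected_le hOmono)
  set δ : ℝ := 1 / ((j : ℝ) + 1) with hδdef
  have hδ : 0 < δ := by positivity
  have hstep : ∀ x ∈ Y, ∃ n, 0 < n ∧ n ≤ j + 1 ∧ W.r x + δ < W.r (F^[n] x) := by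
    intro x hx
    obtain ⟨y, hyY, k, hxy, hy⟩ := W.exists_mem_eq_zpow hYτ hx
    have := hj ⟨hyY, hy.1, hy.2.le⟩
    simp only [hO, mem_iUnion, mem_ofPred_eq] at this
    obtain ⟨n, hn, hlt⟩ := this
    refine ⟨n, Nat.pos_of_ne_zero ?_, hn.trans (Nat.le_succ j), ?_⟩
    · rintro rfl
      simp only [Function.iterate_zero, id] at hlt
      linarith
    · rw [hxy, W.r_iterate_zpow hFτ, W.r_τ_zpow]
      linarith
  have hchain : ∀ k : ℕ, ∃ N : ℕ, k ≤ N ∧ N ≤ (j + 1) * k ∧ W.r x₀ + k * δ ≤ W.r (F^[N] x₀) := by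
    intro k
    induction k with
    | zero => exact ⟨0, le_rfl, by simp, by simp⟩
    | succ k ih =>
      obtain ⟨N, h1, h2, h3⟩ := ih
      obtain ⟨n, hn0, hn, hlt⟩ := hstep _ (hYF.iterate N hx₀)
      refine ⟨n + N, by omega, by rw [mul_add]; omega, ?_⟩
      rw [Function.iterate_add_apply]
      push_cast
      linarith
  have hlim := h0.eventually_lt_const (u := δ / (j + 1)) (by positivity)
  obtain ⟨M, hM⟩ := eventually_atTop.1 hlim
  obtain ⟨N, h1, h2, h3⟩ := hchain (M + 1)
  have h4 := hM N (by omega)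
  have hN : (0 : ℝ) < N := by exact_mod_cast (show 0 < N by omega)
  rw [div_lt_iff₀ hN] at h4
  have h5 : (N : ℝ) ≤ (j + 1) * ((M + 1 : ℕ) : ℝ) := by exact_mod_cast h2
  have h6 : δ / (j + 1) * N ≤ ((M + 1 : ℕ) : ℝ) * δ := by
    rw [div_mul_eq_mul_div, div_le_iff₀ (by positivity)]
    nlinarith
  linarith

/-- A map of degree one that maps a set onto itself, a set with finitely many points modulo the
translation, permutes these points; some iterate acts on them by translations. -/
theorem exists_iterate_eq_zpow {F : T → T} (hFτ : Function.Commute F W.τ) {E : Set T}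
    (hfin : (E ∩ W.r ⁻¹' Icc 0 1).Finite) (hEτ : ∀ x ∈ E, ∀ k : ℤ, (W.τ ^ k) x ∈ E)
    (hsurj : ∀ e ∈ E, ∃ e' ∈ E, F e' = e) :
    ∃ m, 0 < m ∧ ∀ e ∈ E, ∃ k : ℤ, F^[m] e = (W.τ ^ k) e := by
  set E₀ : Set T := E ∩ W.r ⁻¹' Ico 0 1
  have : Finite E₀ :=
    (hfin.subset (inter_subset_inter_right _ (preimage_mono Ico_subset_Icc_self))).to_subtype
  have hrep : ∀ e ∈ E, ∃ y ∈ E₀, ∃ k : ℤ, e = (W.τ ^ k) y := by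
    intro e he
    obtain ⟨y, hyE, k, hxy, hy⟩ := W.exists_mem_eq_zpow hEτ he
    exact ⟨y, ⟨hyE, hy⟩, k, hxy⟩
  -- Preimages are chosen instead of images because `F y` determines `e` modulo `τ`: the choice is
  -- injective on a finite set, hence a permutation.
  have hg : ∀ e : E₀, ∃ y : E₀, ∃ l : ℤ, F y = (W.τ ^ l) e := by
    rintro ⟨e, he⟩
    obtain ⟨e', he', rfl⟩ := hsurj e he.1
    obtain ⟨y, hy, k, rfl⟩ := hrep e' he'
    refine ⟨⟨y, hy⟩, -k, ?_⟩
    change F y = (W.τ ^ (-k)) (F ((W.τ ^ k) y))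
    rw [(W.commute_zpow hFτ k).eq, W.zpow_apply_zpow, neg_add_cancel, zpow_zero]
    rfl
  choose g l hgl using hg
  have hinj : Function.Injective g := by
    intro e₁ e₂ h
    have h1 : (W.τ ^ l e₁) (e₁ : T) = (W.τ ^ l e₂) (e₂ : T) := by rw [← hgl, ← hgl, h]
    have h2 := congrArg W.r h1
    rw [W.r_τ_zpow, W.r_τ_zpow] at h2
    have h3 := e₁.2.2
    have h4 := e₂.2.2
    have h5 : l e₁ = l e₂ := by
      have h6 : ((l e₁ : ℤ) : ℝ) < l e₂ + 1 := by linarith [h3.1, h4.2]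
      have h7 : ((l e₂ : ℤ) : ℝ) < l e₁ + 1 := by linarith [h4.1, h3.2]
      norm_cast at h6 h7
      omega
    rw [h5] at h1
    exact Subtype.ext ((W.τ ^ l e₂).injective h1)
  set σ : Equiv.Perm E₀ := Equiv.ofBijective g (Finite.injective_iff_bijective.1 hinj)
  obtain ⟨m, hm, hσ⟩ := isOfFinOrder_iff_pow_eq_one.1 (isOfFinOrder_of_finite σ)
  have hiter : ∀ (j : ℕ) (e : E₀), ∃ k : ℤ, F^[j] ((σ ^ j) e : E₀) = (W.τ ^ k) (e : T) := by
    intro j e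
    induction j with
    | zero => exact ⟨0, rfl⟩
    | succ j ih =>
      obtain ⟨k, hk⟩ := ih
      refine ⟨l ((σ ^ j) e) + k, ?_⟩
      rw [Function.iterate_succ_apply, pow_succ', Equiv.Perm.mul_apply]
      change F^[j] (F (g ((σ ^ j) e))) = _
      rw [hgl, (W.commute_zpow (hFτ.iterate_left j) _).eq, hk, W.zpow_apply_zpow]
  refine ⟨m, hm, fun e he => ?_⟩
  obtain ⟨y, hy, k, rfl⟩ := hrep e he
  obtain ⟨k', hk'⟩ := hiter m ⟨y, hy⟩
  rw [hσ] at hk'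
  have hk' : F^[m] y = (W.τ ^ k') y := hk'
  refine ⟨k', ?_⟩
  rw [(W.commute_zpow (hFτ.iterate_left m) _).eq, hk', W.zpow_apply_zpow, W.zpow_apply_zpow,
    add_comm]

end Translation

/-! ### Periodic points from bounded orbits; closedness of the map -/

section Periodic

variable {T : Type*} [TopologicalSpace T] [T2Space T] (W : BranchedLine T)

/-- If the iterates of `F` move the line to the right, and the orbit of some point of the line is
bounded on the right, then `F` has a periodic point. -/
theorem exists_periodic_of_forall_le (hr : Continuous W.r) (hW : W.FiniteEnds) {F : T → T}
    (hF : Continuous F) (hFτ : Function.Commute F W.τ) (hright : ∀ t, t < W.r (F (W.h t)))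
    {t₁ a : ℝ} (hb : ∀ n, W.r (F^[n] (W.h t₁)) ≤ a) : ∃ x n, 0 < n ∧ F^[n] x = x := by
  -- The component of `Λᶜ` containing the far right of the line has a finite set of boundary points
  -- outside it. This set contains a point `h t` and is mapped into itself by `F`, so `h t` is
  -- eventually periodic.
  set Λ : Set T := {x | ∀ n, W.r (F^[n] x) ≤ a} with hΛ
  have hΛc : IsClosed Λ := by
    simp only [hΛ, ofPred_forall]
    exact isClosed_iInter fun n => isClosed_le (hr.comp (hF.iterate n)) continuous_const
  have hΛF : ∀ x ∈ Λ, F x ∈ Λ := fun x hx n => by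
    rw [← Function.iterate_succ_apply]; exact hx _
  have hΛF' : ∀ x, W.r x ≤ a → F x ∈ Λ → x ∈ Λ := by
    intro x hx hFx n
    cases n with
    | zero => exact hx
    | succ n => exact hFx n
  have hΛh : ∀ t, W.h t ∈ Λ → t < a := fun t ht => (hright t).trans_le (ht 1)
  set K : Set T := connectedComponentIn Λᶜ (W.h (a + 1)) with hK
  have hKΛ : K ⊆ Λᶜ := connectedComponentIn_subset _ _
  have hKc : IsPreconnected K := isPreconnected_connectedComponentIn
  have hray : ∀ b, (∀ s > b, W.h s ∉ Λ) → b ≤ a → W.h '' Ioi b ⊆ K := by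
    intro b hb hba
    refine (isPreconnected_Ioi.image _ W.continuous_h.continuousOn).subset_connectedComponentIn
      (mem_image_of_mem _ (mem_Ioi.2 (by linarith))) ?_
    rintro _ ⟨s, hs, rfl⟩
    exact hb s hs
  have ht₁ : W.h t₁ ∈ Λ := hb
  obtain ⟨t, ⟨ht, htΛ⟩, hmax⟩ := (isCompact_Icc.inter_right
    (hΛc.preimage W.continuous_h)).exists_isGreatest ⟨t₁, ⟨le_rfl, (hΛh _ ht₁).le⟩, ht₁⟩
  have htK : W.h '' Ioi t ⊆ K := by
    refine hray t (fun s hs hsΛ => ?_) ht.2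
    exact hs.not_ge (hmax ⟨⟨ht.1.trans hs.le, (hΛh s hsΛ).le⟩, hsΛ⟩)
  have hat : t < a := hΛh t htΛ
  have hge : ∀ x ∈ closure K, t ≤ W.r x := by
    have h : ∀ x ∈ K, t ≤ W.r x := fun x hx => by
      by_contra! hlt
      exact hKΛ (W.h_mem_of_isPreconnected hr hKc hx
        (htK (mem_image_of_mem _ (hat.trans (lt_add_one a)))) hlt (by rw [W.r_h]; linarith)) htΛ
    exact fun x hx => closure_minimal h (isClosed_le continuous_const hr) hx
  have hDΛ : ∀ x ∈ closure K \ K, x ∈ Λ := by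
    rintro x ⟨hx, hxK⟩
    by_contra h
    exact hxK (mem_connectedComponentIn_of_mem_closure h hx)
  have hfin : (closure K \ K).Finite := (hW K hKc t a).subset
    fun x hx => ⟨hx, hge x hx.1, hDΛ x hx 0⟩
  have htD : W.h t ∈ closure K \ K := by
    refine ⟨closure_mono htK ?_, fun h => hKΛ h htΛ⟩
    refine image_closure_subset_closure_image W.continuous_h (mem_image_of_mem _ ?_)
    rw [closure_Ioi]; exact self_mem_Ici
  have hIci : W.h '' Ici a ⊆ K := (image_mono fun s hs => hat.trans_le hs).trans htK
  have hcutK : ∀ x ∈ K, W.cut a x ∈ K := by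
    intro x hx
    rcases le_or_gt (W.r x) a with h | h
    · rwa [W.cut_of_le h]
    · rw [W.cut_of_lt h]; exact hIci (mem_image_of_mem _ self_mem_Ici)
  -- A point beyond `a` is outside `Λ` but may be mapped into `Λ`; hence `K` is first cut at `a`.
  -- The cut set joined to the ray is connected, and its image avoids `Λ` and meets `K`.
  have hFK : F '' (W.cut a '' K ∪ W.h '' Ici a) ⊆ K := by
    obtain ⟨R, hR⟩ := W.exists_map_h_eq hr hF hFτ (a + 1)
    have hR' : F (W.h (R + (⌈a - R⌉₊ : ℤ))) = W.h (a + 1 + (⌈a - R⌉₊ : ℤ)) := by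
      rw [← W.τ_zpow_h, (W.commute_zpow hFτ _).eq, hR, W.τ_zpow_h]
    have hmem : W.h (a + 1 + (⌈a - R⌉₊ : ℤ)) ∈ K := by
      refine hIci (mem_image_of_mem _ ?_)
      have : (0 : ℝ) ≤ (⌈a - R⌉₊ : ℤ) := by positivity
      exact mem_Ici.2 (by linarith)
    have hKeq : K = connectedComponentIn Λᶜ (W.h (a + 1 + (⌈a - R⌉₊ : ℤ))) :=
      connectedComponentIn_eq hmem
    refine Subset.trans ?_ hKeq.symm.subset
    refine IsPreconnected.subset_connectedComponentIn (IsPreconnected.image ?_ _ hF.continuousOn)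
      ⟨_, Or.inr (mem_image_of_mem _ ?_), hR'⟩ ?_
    · refine IsPreconnected.union (W.h a) ⟨W.h a, hIci (mem_image_of_mem _ self_mem_Ici), ?_⟩
        (mem_image_of_mem _ self_mem_Ici)
        (hKc.image _ (W.continuous_cut hr a).continuousOn)
        (isPreconnected_Ici.image _ W.continuous_h.continuousOn)
      exact W.cut_of_le (W.r_h a).le
    · have := Nat.le_ceil (a - R)
      rw [mem_Ici]; push_cast; linarith
    · rintro _ ⟨y, ⟨x, hx, rfl⟩ | ⟨s, hs, rfl⟩, rfl⟩ h
      · refine hKΛ (hcutK x hx) (hΛF' _ ?_ h)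
        rw [W.r_cut]; exact min_le_right _ _
      · exact ((mem_Ici.1 hs).trans_lt (hright s)).not_ge (h 0)
  have hmaps : MapsTo F (closure K \ K) (closure K \ K) := by
    intro x hx
    refine ⟨?_, fun h => hKΛ h (hΛF x (hDΛ x hx))⟩
    have h1 : x ∈ closure (W.cut a '' K) := by
      rw [← W.cut_of_le (a := a) (x := x) (hDΛ x hx 0)]
      exact image_closure_subset_closure_image (W.continuous_cut hr a) (mem_image_of_mem _ hx.1)
    refine closure_mono hFK ?_
    exact image_closure_subset_closure_image hF
      (mem_image_of_mem _ (closure_mono subset_union_left h1))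
  have := hfin.to_subtype
  obtain ⟨i, j, hij, heq'⟩ := Finite.exists_ne_map_eq_of_infinite
    fun i : ℕ => (⟨F^[i] (W.h t), hmaps.iterate i htD⟩ : ↥(closure K \ K))
  have heq : F^[i] (W.h t) = F^[j] (W.h t) := congrArg Subtype.val heq'
  clear heq'
  wlog hlt : i < j generalizing i j
  · exact this j i hij.symm heq.symm (lt_of_le_of_ne (not_lt.1 hlt) hij.symm)
  refine ⟨F^[i] (W.h t), j - i, Nat.sub_pos_of_lt hlt, ?_⟩
  rw [← Function.iterate_add_apply, Nat.sub_add_cancel hlt.le, heq]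

/-- The displacement is bounded by compactness modulo `τ`, so near a given point the image of a
closed set comes from a compact part of it. -/
theorem isClosedMap_of_commute (hr : Continuous W.r) {F : T → T} (hF : Continuous F)
    (hFτ : Function.Commute F W.τ) : IsClosedMap F := by
  obtain ⟨c, hc⟩ : ∃ c, ∀ x, |W.r (F x) - W.r x| ≤ c := by
    obtain ⟨c, hc⟩ := ((W.isCompact_preimage (isCompact_Icc (a := (0 : ℝ)) (b := 1))).image
      ((hr.comp hF).sub hr).abs).bddAbove
    refine ⟨c, fun x => ?_⟩
    obtain ⟨y, hxy, hy⟩ := W.exists_eq_zpow x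
    have h1 := W.r_iterate_zpow hFτ 1 ⌊W.r x⌋ y
    have h2 := W.r_τ_zpow ⌊W.r x⌋ y
    rw [← hxy] at h1 h2
    have h3 : W.r (F x) - W.r x = W.r (F y) - W.r y := by
      simp only [Function.iterate_one] at h1
      linarith
    rw [h3]
    exact hc (mem_image_of_mem _ ⟨hy.1, hy.2.le⟩)
  intro S hS
  refine isClosed_of_closure_subset fun y hy => ?_
  have h1 : y ∈ closure (W.r ⁻¹' Ioo (W.r y - 1) (W.r y + 1) ∩ F '' S) :=
    (isOpen_Ioo.preimage hr).inter_closure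
      ⟨⟨sub_one_lt _, lt_add_one _⟩, hy⟩
  have h2 : IsCompact (F '' (S ∩ W.r ⁻¹' Icc (W.r y - 1 - c) (W.r y + 1 + c))) :=
    ((W.isCompact_preimage isCompact_Icc).inter_left hS).image hF
  refine image_mono inter_subset_left (closure_minimal ?_ h2.isClosed h1)
  rintro _ ⟨⟨h3, h4⟩, x, hx, rfl⟩
  have := abs_le.1 (hc x)
  exact ⟨x, ⟨hx, by linarith, by linarith⟩, rfl⟩

end Periodic

end BranchedLine

namespace BranchedLine

/-! ### The boundary of the union of the images of the line -/

section Core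

variable {T : Type*} [TopologicalSpace T] [T2Space T] (W : BranchedLine T)

/-- Let `U` be swept out by the images of the line, with orbits bounded on the left, and such that
the boundary points of `U` that are not in `U` are moved by translations. Then none of them is
moved to the left. -/
theorem le_r_of_mem_closure_diff (hr : Continuous W.r) {H : T → T} (hH : Continuous H)
    (hHτ : Function.Commute H W.τ) (hright : ∀ t, t < W.r (H (W.h t))) {U : Set T}
    (hUh : ∀ t, W.h t ∈ U) (hUH : MapsTo H U U) (hUτ : ∀ x ∈ U, ∀ k : ℤ, (W.τ ^ k) x ∈ U)
    (hUgen : ∀ x ∈ U, ∃ i t, H^[i] (W.h t) = x) (hUlow : ∀ x ∈ U, ∃ c, ∀ n, c ≤ W.r (H^[n] x))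
    (hE : ∀ e ∈ closure U \ U, ∃ k : ℤ, H e = (W.τ ^ k) e) {z : T} (hz : z ∈ closure U \ U) :
    W.r z ≤ W.r (H z) := by
  by_contra! hlt
  set A : Set T := {x | W.r (H x) - W.r x < -(1 / 2)} with hA
  set B : Set T := {x | W.r (H x) - W.r x ≤ -(1 / 2)} with hB
  have hAo : IsOpen A := isOpen_lt ((hr.comp hH).sub hr) continuous_const
  have hBc : IsClosed B := isClosed_le ((hr.comp hH).sub hr) continuous_const
  have hAB : A ⊆ B := fun x hx => le_of_lt (mem_ofPred_eq.mp hx)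
  have hdisp : ∀ (k : ℤ) x, W.r (H ((W.τ ^ k) x)) - W.r ((W.τ ^ k) x) = W.r (H x) - W.r x := by
    intro k x
    rw [(W.commute_zpow hHτ k).eq, W.r_τ_zpow, W.r_τ_zpow]; ring
  have hAτ : ∀ (k : ℤ) x, (W.τ ^ k) x ∈ A ↔ x ∈ A := fun k x => by
    simp only [hA, mem_ofPred_eq, hdisp]
  have hBτ : ∀ (k : ℤ) x, (W.τ ^ k) x ∈ B ↔ x ∈ B := fun k x => by
    simp only [hB, mem_ofPred_eq, hdisp]
  have hzA : z ∈ A := by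
    obtain ⟨k, hk⟩ := hE z hz
    rw [hk, W.r_τ_zpow] at hlt
    have h1 : ((k : ℤ) : ℝ) ≤ -1 := by
      have : (k : ℝ) < 0 := by linarith
      have : k < 0 := by exact_mod_cast this
      exact_mod_cast (show k ≤ -1 by omega)
    change W.r (H z) - W.r z < -(1 / 2)
    rw [hk, W.r_τ_zpow]; linarith
  -- Points outside `A` from which the orbit then stays in `B` for `N` steps. The threshold `-1/2`
  -- is never the displacement of a boundary point, as those are integers.
  set S : ℕ → Set T := fun N => {y | y ∈ closure U ∧ y ∉ A ∧ ∀ n, 1 ≤ n → n ≤ N → H^[n] y ∈ B}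
    with hS
  have hSanti : ∀ {M N}, M ≤ N → S N ⊆ S M := fun hMN y hy =>
    ⟨hy.1, hy.2.1, fun n h1 h2 => hy.2.2 n h1 (h2.trans hMN)⟩
  have hSc : ∀ N, IsClosed (S N) := by
    intro N
    have heq : S N = closure U ∩ (Aᶜ ∩ ⋂ n, ⋂ (_ : 1 ≤ n), ⋂ (_ : n ≤ N), H^[n] ⁻¹' B) := by
      ext y
      simp only [hS, mem_ofPred_eq, mem_inter_iff, mem_iInter, mem_compl_iff, mem_preimage]
    rw [heq]
    refine isClosed_closure.inter (hAo.isClosed_compl.inter ?_)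
    exact isClosed_iInter fun n => isClosed_iInter fun _ => isClosed_iInter fun _ =>
      hBc.preimage (hH.iterate n)
  have hSτ : ∀ N, ∀ y ∈ S N, ∀ k : ℤ, (W.τ ^ k) y ∈ S N := by
    intro N y hy k
    refine ⟨W.zpow_mem_closure hUτ hy.1 k, fun h => hy.2.1 ((hAτ k y).1 h), fun n h1 h2 => ?_⟩
    rw [(W.commute_zpow (hHτ.iterate_left n) k).eq, hBτ]
    exact hy.2.2 n h1 h2
  -- A boundary point and its image have the same integer displacement, which would have to be both
  -- at least and at most `-1/2`.
  have hSU : S 1 ⊆ U := by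
    intro y hy
    by_contra hyU
    obtain ⟨k, hk⟩ := hE y ⟨hy.1, hyU⟩
    have h1 : W.r (H (H y)) - W.r (H y) ≤ -(1 / 2) := hy.2.2 1 le_rfl le_rfl
    have h2 : ¬ W.r (H y) - W.r y < -(1 / 2) := hy.2.1
    rw [hk, hdisp, hk, W.r_τ_zpow] at h1
    rw [hk, W.r_τ_zpow] at h2
    have h3 : (k : ℝ) = -(1 / 2) := by linarith
    have h4 : ((2 * k : ℤ) : ℝ) = ((-1 : ℤ) : ℝ) := by push_cast; linarith
    have h5 : 2 * k = -1 := by exact_mod_cast h4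
    omega
  -- A point in all `S N`, provided by compactness, would be in `U` and drift left by at least `1/2`
  -- per step, against `hUlow`.
  obtain ⟨N, hN⟩ : ∃ N, S N = ∅ := by
    by_contra! hne
    have hne' : ∀ N, (S N ∩ W.r ⁻¹' Icc 0 1).Nonempty := by
      intro N
      obtain ⟨x, hx⟩ := hne N
      obtain ⟨y, hy, -, -, hy1⟩ := W.exists_mem_eq_zpow (hSτ N) hx
      exact ⟨y, hy, hy1.1, hy1.2.le⟩
    obtain ⟨y, hy⟩ := IsCompact.nonempty_iInter_of_sequence_nonempty_isCompact_isClosed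
      (fun N => S N ∩ W.r ⁻¹' Icc 0 1)
      (fun N => inter_subset_inter_left _ (hSanti (Nat.le_succ N))) hne'
      ((W.isCompact_preimage isCompact_Icc).inter_left (hSc 0))
      (fun N => (hSc N).inter (W.isCompact_preimage isCompact_Icc).isClosed)
    have hyS : ∀ N, y ∈ S N := fun N => (mem_iInter.1 hy N).1
    obtain ⟨c, hc⟩ := hUlow y (hSU (hyS 1))
    have hdec : ∀ n : ℕ, W.r (H^[n + 1] y) ≤ W.r (H y) - n / 2 := by
      intro n
      induction n with
      | zero => simp
      | succ n ih =>
        have h1 : W.r (H (H^[n + 1] y)) - W.r (H^[n + 1] y) ≤ -(1 / 2) :=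
          (hyS (n + 1)).2.2 (n + 1) (by omega) le_rfl
        rw [Function.iterate_succ_apply' H (n + 1)]
        push_cast
        linarith
    obtain ⟨n, hn⟩ := exists_nat_gt (2 * (W.r (H y) - c))
    linarith [hdec n, hc (n + 1)]
  -- Go back to the last time the orbit was outside `A`; its start on the line is such a time.
  have hback : ∀ i t, ∃ n, ∃ y ∈ U, y ∉ A ∧ H^[n] y = H^[i] (W.h t) ∧
      ∀ l, 1 ≤ l → l ≤ n → H^[l] y ∈ A := by
    intro i t
    induction i with
    | zero =>
      refine ⟨0, W.h t, hUh t, fun h => ?_, rfl, fun l h1 h2 => by omega⟩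
      have h1 : W.r (H (W.h t)) - W.r (W.h t) < -(1 / 2) := h
      rw [W.r_h] at h1
      linarith [hright t]
    | succ i ih =>
      obtain ⟨n, y, hyU, hyA, hy, hl⟩ := ih
      by_cases h : H^[i + 1] (W.h t) ∈ A
      · have h1 : H^[n + 1] y = H^[i + 1] (W.h t) := by
          rw [Function.iterate_succ_apply', hy, ← Function.iterate_succ_apply' H]
        refine ⟨n + 1, y, hyU, hyA, h1, fun l hl1 hl2 => ?_⟩
        rcases hl2.lt_or_eq with h2 | rfl
        · exact hl l hl1 (by omega)
        · rwa [h1]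
      · exact ⟨0, _, hUH.iterate (i + 1) (hUh t), h, rfl, fun l h1 h2 => by omega⟩
  -- A closed subset of `U` containing `A ∩ U`. Since `A` is an open neighbourhood of `z`, it would
  -- contain `z`.
  set Q : Set T := ⋃ n ∈ Iic N, H^[n] '' S 1 with hQ
  have hQc : IsClosed Q := (finite_Iic N).isClosed_biUnion fun n _ =>
    W.isClosedMap_of_commute hr (hH.iterate n) (hHτ.iterate_left n) _ (hSc 1)
  have hQU : Q ⊆ U := by
    refine iUnion₂_subset fun n _ => ?_
    rintro _ ⟨y, hy, rfl⟩
    exact hUH.iterate n (hSU hy)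
  have hUAQ : A ∩ U ⊆ Q := by
    rintro u ⟨huA, huU⟩
    obtain ⟨i, t, rfl⟩ := hUgen u huU
    obtain ⟨n, y, hyU, hyA, hy, hl⟩ := hback i t
    have hn0 : 1 ≤ n := by
      by_contra! h
      obtain rfl : n = 0 := by omega
      have hy : y = H^[i] (W.h t) := hy
      exact hyA (hy ▸ huA)
    have hySn : y ∈ S n := ⟨subset_closure hyU, hyA, fun l h1 h2 => hAB (hl l h1 h2)⟩
    have hnN : n ≤ N := by
      by_contra! h
      have := hSanti h.le hySn
      rw [hN] at this
      exact this
    exact mem_biUnion (mem_Iic.2 hnN) ⟨y, hSanti hn0 hySn, hy⟩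
  have h1 : z ∈ closure (A ∩ U) := hAo.inter_closure ⟨hzA, hz.1⟩
  exact hz.2 (hQU (closure_minimal hUAQ hQc h1))

/-- A map of degree one with a point of rotation number zero on the line, but no periodic points of
negative rotation number on the line, has a periodic point of rotation number zero. -/
theorem exists_periodic (hr : Continuous W.r) (hW : W.FiniteEnds) {F : T → T}
    (hF : Continuous F) (hFτ : Function.Commute F W.τ)
    (hneg : ∀ n : ℕ, 0 < n → ∀ t, ∀ k : ℤ, k < 0 → F^[n] (W.h t) ≠ W.h (t + k))
    {t₀ : ℝ} (h0 : Tendsto (fun n : ℕ => (W.r (F^[n] (W.h t₀)) - t₀) / n) atTop (𝓝 0)) :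
    ∃ x n, 0 < n ∧ F^[n] x = x := by
  by_contra! hper
  have hright : ∀ n : ℕ, 0 < n → ∀ t, t < W.r (F^[n] (W.h t)) := fun n hn t =>
    W.lt_r_iterate hr hF hFτ (fun n hn t k hk => by
      rcases hk.lt_or_eq with h | rfl
      · exact hneg n hn t k h
      · simpa using hper (W.h t) n hn) h0 hn t
  have hunb : ∀ t a, ∃ n, a < W.r (F^[n] (W.h t)) := by
    intro t a
    by_contra! h
    obtain ⟨x, n, hn, hx⟩ := W.exists_periodic_of_forall_le hr hW hF hFτ (hright 1 one_pos) h
    exact hper x n hn hx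
  have hFn : ∀ m, Function.Commute F^[m] W.τ := fun m => hFτ.iterate_left m
  set U : Set T := ⋃ n : ℕ, range fun t => F^[n] (W.h t) with hU
  have hmem : ∀ x, x ∈ U ↔ ∃ n t, F^[n] (W.h t) = x := fun x => by simp [hU]
  have hUh : ∀ t, W.h t ∈ U := fun t => (hmem _).2 ⟨0, t, rfl⟩
  have hUF : MapsTo F U U := by
    intro x hx
    obtain ⟨n, t, rfl⟩ := (hmem x).1 hx
    exact (hmem _).2 ⟨n + 1, t, Function.iterate_succ_apply' F n _⟩
  have hUτ : ∀ x ∈ U, ∀ k : ℤ, (W.τ ^ k) x ∈ U := by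
    intro x hx k
    obtain ⟨n, t, rfl⟩ := (hmem x).1 hx
    exact (hmem _).2 ⟨n, t + k, by rw [← W.τ_zpow_h, (W.commute_zpow (hFn n) k).eq]⟩
  have hUlow : ∀ x ∈ U, ∃ c, ∀ n, c ≤ W.r (F^[n] x) := by
    intro x hx
    obtain ⟨i, t, rfl⟩ := (hmem x).1 hx
    refine ⟨t, fun n => ?_⟩
    rw [← Function.iterate_add_apply]
    rcases Nat.eq_zero_or_pos (n + i) with h | h
    · rw [h]; exact (W.r_h t).ge
    · exact (hright _ h t).le
  have hUc : IsPreconnected U := by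
    refine isPreconnected_iUnion ⟨W.h 0, mem_iInter.2 fun n => ?_⟩ fun n =>
      isPreconnected_range ((hF.iterate n).comp W.continuous_h)
    exact W.exists_map_h_eq hr (hF.iterate n) (hFn n) 0
  have hYτ : ∀ x ∈ closure U, ∀ k : ℤ, (W.τ ^ k) x ∈ closure U := fun x hx k =>
    W.zpow_mem_closure hUτ hx k
  obtain ⟨z, hz, hzle⟩ := W.exists_forall_r_iterate_le hr hF hFτ isClosed_closure
    (hUF.closure hF) hYτ (subset_closure (hUh t₀)) (by simpa only [W.r_h] using h0)
  have hzU : z ∉ U := by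
    intro h
    obtain ⟨i, t, rfl⟩ := (hmem z).1 h
    obtain ⟨b, hb⟩ := ((finite_Iio i).image fun n => W.r (F^[n] (W.h t))).bddAbove
    obtain ⟨n, hn⟩ := hunb t (max b (W.r (F^[i] (W.h t))))
    rw [max_lt_iff] at hn
    rcases lt_or_ge n i with h | h
    · exact hn.1.not_ge (hb (mem_image_of_mem _ h))
    · have := hzle (n - i)
      rw [← Function.iterate_add_apply, Nat.sub_add_cancel h] at this
      exact hn.2.not_ge this
  -- `F` is closed and `U ⊆ F (closure U)`, so boundary points have preimages in `closure U`; these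
  -- are not in `U`, which `F` preserves.
  have hEsurj : ∀ e ∈ closure U \ U, ∃ e' ∈ closure U \ U, F e' = e := by
    rintro e ⟨he, heU⟩
    have h1 : U ⊆ F '' closure U := by
      intro x hx
      obtain ⟨n, t, rfl⟩ := (hmem x).1 hx
      obtain ⟨s, hs⟩ := W.exists_map_h_eq hr hF hFτ t
      refine ⟨F^[n] (W.h s), subset_closure ((hmem _).2 ⟨n, s, rfl⟩), ?_⟩
      rw [← Function.iterate_succ_apply' F, Function.iterate_succ_apply, hs]
    obtain ⟨e', he', rfl⟩ := closure_minimal h1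
      (W.isClosedMap_of_commute hr hF hFτ _ isClosed_closure) he
    exact ⟨e', ⟨he', fun h => heU (hUF h)⟩, rfl⟩
  have hEτ : ∀ x ∈ closure U \ U, ∀ k : ℤ, (W.τ ^ k) x ∈ closure U \ U := by
    rintro x ⟨hx, hxU⟩ k
    refine ⟨hYτ x hx k, fun h => hxU ?_⟩
    have := hUτ _ h (-k)
    rw [W.zpow_apply_zpow, neg_add_cancel, zpow_zero] at this
    exact this
  obtain ⟨m, hm, hmE⟩ := W.exists_iterate_eq_zpow hFτ (hW U hUc 0 1) hEτ hEsurj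
  -- As `F^[m * n - n]` covers the line, the exponent `n` can be padded to a multiple of `m`.
  have hgen : ∀ x ∈ U, ∃ i t, (F^[m])^[i] (W.h t) = x := by
    intro x hx
    obtain ⟨n, t, rfl⟩ := (hmem x).1 hx
    have hnm : n ≤ m * n := Nat.le_mul_of_pos_left n hm
    obtain ⟨s, hs⟩ := W.exists_map_h_eq hr (hF.iterate (m * n - n)) (hFn _) t
    refine ⟨n, s, ?_⟩
    rw [← Function.iterate_mul, ← hs, ← Function.iterate_add_apply, Nat.add_sub_cancel' hnm]
  have hge := W.le_r_of_mem_closure_diff hr (hF.iterate m) (hFn m) (hright m hm) hUh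
    (hUF.iterate m) hUτ hgen (fun x hx => by
      obtain ⟨c, hc⟩ := hUlow x hx
      exact ⟨c, fun n => by rw [← Function.iterate_mul]; exact hc _⟩) hmE ⟨hz, hzU⟩
  obtain ⟨k, hk⟩ := hmE z ⟨hz, hzU⟩
  have h1 := le_antisymm (hzle m) hge
  rw [hk, W.r_τ_zpow] at h1
  have h2 : k = 0 := by
    have : (k : ℝ) = 0 := by linarith
    exact_mod_cast this
  rw [h2, zpow_zero] at hk
  exact hper z m hm hk

end Core

end BranchedLine

namespace BranchedLine

/-! ### Periodic points via the finer topology -/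

section FinePeriodic

variable {T : Type*} [MetricSpace T] (W : BranchedLine T)

/-- Being periodic does not depend on the topology, so the finer one may be used; the second
alternative becomes the first on the reversed line. -/
theorem exists_periodic_of_isFiniteGraph (hG : IsFiniteGraph (W.r ⁻¹' Icc 0 1)) {F : T → T}
    (hF : Continuous F) (hFτ : Function.Commute F W.τ) {t₀ : ℝ}
    (h0 : Tendsto (fun n : ℕ => (W.r (F^[n] (W.h t₀)) - t₀) / n) atTop (𝓝 0))
    (hno : (∀ n : ℕ, 0 < n → ∀ t, ∀ k : ℤ, k < 0 → F^[n] (W.h t) ≠ W.h (t + k)) ∨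
      ∀ n : ℕ, 0 < n → ∀ t, ∀ k : ℤ, 0 < k → F^[n] (W.h t) ≠ W.h (t + k)) :
    ∃ x n, 0 < n ∧ F^[n] x = x := by
  set F' : W.Fine → W.Fine := fun x => W.toFine (F (W.toFine.symm x)) with hF'
  have hiter : ∀ n x, F'^[n] (W.toFine x) = W.toFine (F^[n] x) := fun n x =>
    ((Function.Semiconj.iterate_right (f := W.toFine) (ga := F) (gb := F') (fun x => rfl) n).eq x).symm
  have hcont : Continuous F' := W.continuous_fine_map hG hF hFτ
  have hcomm : Function.Commute F' W.fine.τ := fun x =>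
    congrArg W.toFine (hFτ (W.toFine.symm x))
  have hends := W.finiteEnds_fine hG
  suffices h : ∃ x n, 0 < n ∧ F'^[n] x = x by
    obtain ⟨x, n, hn, hx⟩ := h
    refine ⟨W.toFine.symm x, n, hn, W.toFine.injective ?_⟩
    rw [← hiter, W.toFine.apply_symm_apply, hx]
  rcases hno with hno | hno
  · refine W.fine.exists_periodic W.continuous_r_toFine_symm hends hcont hcomm
      (fun n hn t k hk h => hno n hn t k hk ?_) (t₀ := t₀) ?_
    · have h : F'^[n] (W.toFine (W.h t)) = W.toFine (W.h (t + k)) := h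
      rw [hiter] at h
      exact W.toFine.injective h
    · have h1 : ∀ n, W.fine.r (F'^[n] (W.fine.h t₀)) = W.r (F^[n] (W.h t₀)) := fun n =>
        congrArg W.fine.r (hiter n _)
      simpa only [h1] using h0
  · refine W.fine.neg.exists_periodic W.continuous_r_toFine_symm.neg hends.neg hcont (fun x => ?_)
      (fun n hn t k hk h => hno n hn (-t) (-k) (neg_pos.2 hk) ?_) (t₀ := -t₀) ?_
    · apply W.fine.τ.injective
      change W.fine.τ (F' (W.fine.τ.symm x)) = W.fine.τ (W.fine.τ.symm (F' x))
      rw [← hcomm.eq, W.fine.τ.apply_symm_apply, W.fine.τ.apply_symm_apply]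
    · have h : F'^[n] (W.toFine (W.h (-t))) = W.toFine (W.h (-(t + k))) := h
      rw [hiter, neg_add] at h
      push_cast
      exact W.toFine.injective h
    · have h1 : ∀ n, W.fine.neg.r (F'^[n] (W.fine.neg.h (-t₀))) = -W.r (F^[n] (W.h t₀)) := fun n => by
        change -W.r (W.toFine.symm (F'^[n] (W.toFine (W.h (- -t₀))))) = _
        rw [hiter, neg_neg, Equiv.symm_apply_apply]
      simp only [h1]
      have h2 := h0.neg
      rw [neg_zero] at h2
      refine h2.congr fun n => ?_
      ring

end FinePeriodic

/-! ### Rotation numbers of periodic points -/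

section RotationNumber

variable {T : Type*} [TopologicalSpace T] (W : BranchedLine T)

/-- The deviation from linear growth is periodic in `n`, hence bounded. -/
theorem tendsto_rotation_of_iterate_eq {F : T → T} (hFτ : Function.Commute F W.τ) {x : T} {N : ℕ}
    (hN : 0 < N) {K : ℤ} (hx : F^[N] x = (W.τ ^ K) x) :
    Tendsto (fun n : ℕ => (W.r (F^[n] x) - W.r x) / n) atTop (𝓝 ((K : ℝ) / N)) := by
  have hN' : (N : ℝ) ≠ 0 := by positivity
  set b : ℕ → ℝ := fun n => W.r (F^[n] x) - W.r x - n * (K / N) with hb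
  have hper : Function.Periodic b N := by
    intro n
    simp only [hb]
    rw [Function.iterate_add_apply, hx, W.r_iterate_zpow hFτ]
    push_cast
    field_simp
    ring
  obtain ⟨C, hC⟩ := ((finite_Iio N).image fun n => |b n|).bddAbove
  have hbC : ∀ n, |b n| ≤ C := fun n => by
    rw [← hper.map_mod_nat n]
    exact hC (mem_image_of_mem _ (Nat.mod_lt n hN))
  have h1 : Tendsto (fun n : ℕ => b n / n) atTop (𝓝 0) := by
    refine squeeze_zero_norm (fun n => ?_) (tendsto_const_div_atTop_nhds_zero_nat C)
    rw [Real.norm_eq_abs, abs_div, Nat.abs_cast]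
    exact div_le_div_of_nonneg_right (hbC n) (Nat.cast_nonneg n)
  have h2 := h1.add_const ((K : ℝ) / N)
  rw [zero_add] at h2
  refine h2.congr' ?_
  filter_upwards [eventually_gt_atTop 0] with n hn
  have hn' : (n : ℝ) ≠ 0 := by positivity
  simp only [hb]
  field_simp
  ring

end RotationNumber

end BranchedLine

/-! ### Lifted spaces as branched lines, and the reduction to rotation number zero -/

namespace LiftedSpace

variable {T : Type*} [MetricSpace T] [ConnectedSpace T] (L : LiftedSpace T)

theorem r_h (t : ℝ) : L.r (L.h t) = t := L.r_eq_of_isFoot (Or.inl rfl)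

theorem eq_h_r_of_mem_range {x : T} (hx : x ∈ range L.h) : x = L.h (L.r x) := by
  obtain ⟨t, rfl⟩ := hx
  rw [L.r_h]

theorem r_eq_of_mem_closure {x y : T} (hx : x ∉ range L.h)
    (hy : y ∈ closure (connectedComponentIn (range L.h)ᶜ x)) : L.r y = L.r x := by
  have hfoot : L.h (L.r x) ∈ closure (connectedComponentIn (range L.h)ᶜ x) := by
    rcases L.isFoot_r x with h | h
    · exact absurd ⟨_, h.symm⟩ hx
    · exact h.2
  by_cases hyr : y ∈ range L.h
  · obtain ⟨-, z, hz⟩ := L.closure_component _ ⟨x, hx, rfl⟩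
    have h1 : y ∈ ({z} : Set T) := hz ▸ ⟨hy, hyr⟩
    have h2 : L.h (L.r x) ∈ ({z} : Set T) := hz ▸ ⟨hfoot, mem_range_self _⟩
    rw [mem_singleton_iff] at h1 h2
    rw [h1, ← h2, L.r_h]
  · have h1 := mem_connectedComponentIn_of_mem_closure (S := (range L.h)ᶜ) hyr hy
    exact L.r_eq_of_isFoot (Or.inr ⟨hyr, connectedComponentIn_eq h1 ▸ hfoot⟩)

theorem image_compl_range {φ : T ≃ₜ T} {c : ℝ} (hφ : ∀ t, φ (L.h t) = L.h (t + c)) :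
    φ '' (range L.h)ᶜ = (range L.h)ᶜ := by
  rw [image_compl_eq φ.bijective, ← range_comp]
  congr 1
  ext x
  constructor
  · rintro ⟨t, rfl⟩
    exact ⟨t + c, (hφ t).symm⟩
  · rintro ⟨t, rfl⟩
    exact ⟨t - c, by simp [hφ]⟩

theorem image_component {φ : T ≃ₜ T} {c : ℝ} (hφ : ∀ t, φ (L.h t) = L.h (t + c)) {x : T}
    (hx : x ∉ range L.h) : φ '' connectedComponentIn (range L.h)ᶜ x =
      connectedComponentIn (range L.h)ᶜ (φ x) := by
  rw [φ.image_connectedComponentIn hx, L.image_compl_range hφ]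

theorem r_τ (x : T) : L.r (L.τ x) = L.r x + 1 := by
  refine L.r_eq_of_isFoot ?_
  rcases L.isFoot_r x with h | ⟨hx, h⟩
  · left
    rw [← L.τ_h, ← h]
  · right
    have h1 := L.image_compl_range L.τ_h
    refine ⟨?_, ?_⟩
    · have : L.τ x ∈ L.τ '' (range L.h)ᶜ := mem_image_of_mem _ hx
      rw [h1] at this
      exact this
    · rw [← L.image_component L.τ_h hx, ← L.τ.image_closure, ← L.τ_h]
      exact mem_image_of_mem _ h

theorem finite_components_Icc (a b : ℝ) :
    {C : Set T | IsComponentOf C (range L.h)ᶜ ∧ (closure C ∩ L.h '' Icc a b).Nonempty}.Finite := by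
  have hj : ∀ j : ℤ, {C : Set T | IsComponentOf C (range L.h)ᶜ ∧
      (closure C ∩ L.h '' Icc (j : ℝ) (j + 1)).Nonempty}.Finite := by
    intro j
    refine (L.finite_components.image fun C => (L.τ ^ j) '' C).subset ?_
    rintro _ ⟨⟨x, hx, rfl⟩, _, hy, t, ht, rfl⟩
    have hφ := zpow_apply_line L.τ_h (-j)
    have hinv : ∀ y, (L.τ ^ j) ((L.τ ^ (-j)) y) = y := fun y => by
      rw [← Homeomorph.mul_apply, ← zpow_add, add_neg_cancel, zpow_zero]; rfl
    have hx' : (L.τ ^ (-j)) x ∈ (range L.h)ᶜ := by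
      rw [← L.image_compl_range hφ]
      exact mem_image_of_mem _ hx
    refine ⟨connectedComponentIn (range L.h)ᶜ ((L.τ ^ (-j)) x), ⟨⟨_, hx', rfl⟩, ?_⟩, ?_⟩
    · rw [← L.image_component hφ hx, ← (L.τ ^ (-j)).image_closure]
      refine ⟨_, mem_image_of_mem _ hy, t + (-j : ℤ), ?_, (hφ t).symm⟩
      push_cast
      exact ⟨by linarith [ht.1], by linarith [ht.2]⟩
    · change (L.τ ^ j) '' _ = _
      rw [L.image_component (zpow_apply_line L.τ_h j) hx', hinv]
  refine ((finite_Icc ⌊a⌋ ⌊b⌋).biUnion fun j _ => hj j).subset ?_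
  rintro C ⟨hC, y, hy, t, ht, rfl⟩
  exact mem_biUnion (x := ⌊t⌋) ⟨Int.floor_mono ht.1, Int.floor_mono ht.2⟩
    ⟨hC, L.h t, hy, t, ⟨Int.floor_le t, (Int.lt_floor_add_one t).le⟩, rfl⟩

/-- Finitely many components are attached over a bounded interval, each with compact closure on
which `r` is constant. -/
theorem isCompact_over (B D : Set ℝ) (hB : IsCompact B) :
    IsCompact {x | L.r x ∈ B ∧ (L.r x ∈ D ∨ x ∈ range L.h)} := by
  obtain ⟨a, ha⟩ := hB.bddBelow
  obtain ⟨b, hb⟩ := hB.bddAbove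
  set 𝒞 : Set (Set T) :=
    {C | ∃ x ∉ range L.h, C = connectedComponentIn (range L.h)ᶜ x ∧ L.r x ∈ B ∧ L.r x ∈ D}
  have h𝒞 : 𝒞.Finite := by
    refine (L.finite_components_Icc a b).subset ?_
    rintro _ ⟨x, hx, rfl, hxB, -⟩
    refine ⟨⟨x, hx, rfl⟩, L.h (L.r x), ?_, mem_image_of_mem _ ⟨ha hxB, hb hxB⟩⟩
    rcases L.isFoot_r x with h | h
    · exact absurd ⟨_, h.symm⟩ hx
    · exact h.2
  have heq : {x | L.r x ∈ B ∧ (L.r x ∈ D ∨ x ∈ range L.h)} =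
      L.h '' B ∪ ⋃ C ∈ 𝒞, closure C := by
    ext x
    constructor
    · rintro ⟨hxB, hx⟩
      by_cases hxr : x ∈ range L.h
      · exact Or.inl ⟨_, hxB, (L.eq_h_r_of_mem_range hxr).symm⟩
      · exact Or.inr (mem_biUnion ⟨x, hxr, rfl, hxB, hx.resolve_right hxr⟩
          (subset_closure (mem_connectedComponentIn hxr)))
    · rintro (⟨t, ht, rfl⟩ | hx)
      · exact ⟨(L.r_h t).symm ▸ ht, Or.inr (mem_range_self t)⟩
      · obtain ⟨_, ⟨y, hy, rfl, hyB, hyD⟩, hx⟩ := mem_iUnion₂.1 hx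
        have h := L.r_eq_of_mem_closure hy hx
        exact ⟨h ▸ hyB, Or.inl (h ▸ hyD)⟩
  rw [heq]
  refine (hB.image L.isEmbedding_h.continuous).union (h𝒞.isCompact_biUnion ?_)
  rintro _ ⟨x, hx, rfl, -⟩
  exact (L.closure_component _ ⟨x, hx, rfl⟩).1

/-- The line of a lifted space, with its retraction and its translation. -/
noncomputable def toBranchedLine : BranchedLine T where
  r := L.r
  h := L.h
  τ := L.τ
  continuous_h := L.isEmbedding_h.continuous
  r_h := L.r_h
  r_τ := L.r_τ
  τ_h := L.τ_h
  isCompact_over := L.isCompact_over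

theorem hasRotationNumber_iff {F : T → T} {x : T} {ρ : ℝ} : L.HasRotationNumber F x ρ ↔
    Tendsto (fun n : ℕ => (L.r (F^[n] x) - L.r x) / n) atTop (𝓝 ρ) := by
  rw [← EReal.tendsto_coe]
  constructor
  · rintro ⟨h1, h2⟩
    exact tendsto_of_liminf_eq_limsup h1 h2
  · intro h
    exact ⟨h.liminf_eq, h.limsup_eq⟩

/-- An end point `p / q` of the rotation set of the line is the rotation number of a periodic
point. -/
theorem exists_isPeriodicModOne (hL : L.IsInfiniteGraph) {F : T → T} (hF : L.IsDegreeOne F)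
    {p : ℤ} {q : ℕ} (hq : 0 < q) (hmem : (p : ℝ) / q ∈ L.rotR F)
    (hext : (p : ℝ) / q ∈ lowerBounds (L.rotR F) ∨ (p : ℝ) / q ∈ upperBounds (L.rotR F)) :
    ∃ x : T, L.IsPeriodicModOne F x ∧ L.HasRotationNumber F x ((p : ℝ) / q) := by
  set W := L.toBranchedLine with hW
  have hFτ : Function.Commute F W.τ := hF.2
  set G : T → T := fun x => (W.τ ^ (-p)) (F^[q] x) with hG
  have hGτ : Function.Commute G W.τ := W.zpow_comp_commute (hFτ.iterate_left q) (-p)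
  have hGc : Continuous G := (W.τ ^ (-p)).continuous.comp (hF.1.iterate q)
  have hiter : ∀ n x, F^[q * n] x = (W.τ ^ (p * n)) (G^[n] x) := by
    intro n x
    induction n with
    | zero => simp
    | succ n ih =>
      rw [mul_add, mul_one, add_comm, Function.iterate_add_apply, ih,
        (W.commute_zpow (hFτ.iterate_left q) _).eq, Function.iterate_succ_apply']
      simp only [hG]
      rw [W.zpow_apply_zpow]
      congr 2
      push_cast; ring
  have hq' : (0 : ℝ) < q := by exact_mod_cast hq
  have hrot : ∀ n x (k : ℤ), 0 < n → G^[n] x = (W.τ ^ k) x →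
      F^[q * n] x = (W.τ ^ (p * n + k)) x ∧
      L.HasRotationNumber F x ((p : ℝ) / q + k / (q * n)) := by
    intro n x k hn hx
    have h1 : F^[q * n] x = (W.τ ^ (p * n + k)) x := by rw [hiter, hx, W.zpow_apply_zpow]
    refine ⟨h1, L.hasRotationNumber_iff.2 ?_⟩
    have h2 := W.tendsto_rotation_of_iterate_eq hFτ (Nat.mul_pos hq hn) h1
    have hn' : (0 : ℝ) < n := by exact_mod_cast hn
    have h3 : ((p * n + k : ℤ) : ℝ) / ((q * n : ℕ) : ℝ) = (p : ℝ) / q + k / (q * n) := by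
      push_cast
      field_simp
    rw [h3] at h2
    exact h2
  obtain ⟨t₀, ht₀⟩ := hmem
  have h0 : Tendsto (fun n : ℕ => (W.r (G^[n] (W.h t₀)) - t₀) / n) atTop (𝓝 0) := by
    have h1 := ((L.hasRotationNumber_iff.1 ht₀).comp (tendsto_id.const_mul_atTop' hq)).const_mul
      (q : ℝ) |>.sub_const (p : ℝ)
    rw [mul_div_cancel₀ _ hq'.ne', sub_self] at h1
    refine h1.congr' ?_
    filter_upwards [eventually_gt_atTop 0] with n hn
    have hn' : (0 : ℝ) < n := by exact_mod_cast hn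
    have h2 : L.r (F^[q * n] (L.h t₀)) = W.r (G^[n] (W.h t₀)) + (p * n : ℤ) := by
      rw [← W.r_τ_zpow, ← hiter]; rfl
    simp only [Function.comp_apply, id]
    rw [h2, L.r_h]
    push_cast
    field_simp
    ring
  -- A point `h t` with `G^[n] (h t) = h (t + k)` has rotation number `p/q + k/(q n)` for `F`;
  -- extremality excludes one sign of `k`.
  obtain ⟨x, n, hn, hx⟩ := W.exists_periodic_of_isFiniteGraph hL hGc hGτ h0 (by
    refine hext.imp (fun hlow n hn t k hk h => ?_) (fun hup n hn t k hk h => ?_)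
    · have h1 := hlow ⟨t, (hrot n (W.h t) k hn (by rw [h, W.τ_zpow_h])).2⟩
      have hn' : (0 : ℝ) < n := by exact_mod_cast hn
      have hk' : (k : ℝ) < 0 := by exact_mod_cast hk
      have : (k : ℝ) / (q * n) < 0 := div_neg_of_neg_of_pos hk' (by positivity)
      linarith
    · have h1 := hup ⟨t, (hrot n (W.h t) k hn (by rw [h, W.τ_zpow_h])).2⟩
      have hn' : (0 : ℝ) < n := by exact_mod_cast hn
      have hk' : (0 : ℝ) < k := by exact_mod_cast hk
      have : 0 < (k : ℝ) / (q * n) := by positivity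
      linarith)
  obtain ⟨h1, h2⟩ := hrot n x 0 hn (by rw [hx, zpow_zero]; rfl)
  refine ⟨x, ⟨q * n, Nat.mul_pos hq hn, _, h1⟩, ?_⟩
  simpa using h2

end LiftedSpace

theorem mainTheorem7 {T : Type*} [MetricSpace T] [ConnectedSpace T] (L : LiftedSpace T)
    (hL : L.IsInfiniteGraph) (F : T → T) (hF : L.IsDegreeOne F)
    (p : ℤ) (q : ℕ) (hq : 0 < q) :
    (IsLeast (L.rotR F) ((p : ℝ) / (q : ℝ)) →
      ∃ x : T, L.IsPeriodicModOne F x ∧ L.HasRotationNumber F x ((p : ℝ) / (q : ℝ))) ∧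
    (IsGreatest (L.rotR F) ((p : ℝ) / (q : ℝ)) →
      ∃ x : T, L.IsPeriodicModOne F x ∧ L.HasRotationNumber F x ((p : ℝ) / (q : ℝ))) :=
  ⟨fun h => L.exists_isPeriodicModOne hL hF hq h.1 (Or.inl h.2),
    fun h => L.exists_isPeriodicModOne hL hF hq h.1 (Or.inr h.2)⟩
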